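/- Let $\mathbb{F}_q$ be a finite field and let $F$ be a subset of its algebraic closure $\overline{\mathbb{F}}_q$. Let $\mathcal Y=\mathcal Y_F$ be the class of all linear endomorphisms $T$ of finite-dimensional $\mathbb{F}_q$-vector spaces such that all eigenvalues of $T$ over $\overline{\mathbb{F}}_q$ lie in $F$. For an integer $n\ge 0$, let $c(n,\mathcal Y)$ be the number of $\mathrm{GL}_n(\mathbb{F}_q)$-conjugacy classes of elements of $\mathcal Y\cap \mathrm{M}_n(\mathbb{F}_q)$. Let $k,m\ge 0$ be integers and let $$V\stackrel{\iota}{\hookrightarrow} Z\stackrel{p}{\twoheadrightarrow} W$$ be linear maps of finite-dimensional $\mathbb{F}_q$-vector spaces, where $\iota$ is injective, $p$ is surjective, $\operatorname{im}\iota=\ker p$, $\dim V=k$ and $\dim W=m$. Let $Q^k$ be this quiver representation. Thus $\operatorname{End}(Q^k)$ is the ring of triples $X=(X_V,X_Z,X_W)\in\operatorname{End}(V)\times\operatorname{End}(Z)\times\operatorname{End}(W)$ with $\iota X_V=X_Z\iota$ and $pX_Z=X_Wp$, and $\operatorname{Aut}(Q^k)$ is its group of units, which acts on $\operatorname{End}(Q^k)$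 by conjugation. Let $G$ be a subgroup of $\mathrm{GL}(W)$, and let $A\subseteq\operatorname{End}(W)\cap\mathcal Y$ be a set with $gAg^{-1}\subseteq A$ for all $g\in G$. Put $$G^{(k)}=\{g\in\operatorname{Aut}(Q^k): g_W\in G\},\qquad A^{(k)}_{\mathcal Y}=\{X\in \operatorname{End}(Q^k): X_W\in A \text{ and } X_V,X_Z,X_W\in\mathcal Y\}.$$ For a partition $\lambda=(\lambda_1\ge\cdots\ge\lambda_s>0)$ with $\lambda_1\le m$ (possibly $s=0$), let $\xi_\lambda(G,A)$ be the number of $G$-orbits on the set of pairs $((W_1,\ldots,W_s),R)$ such that $W\ge W_1\ge\cdots\ge W_s$ are subspaces with $\dim W_i=\lambda_i$ for all $i$, $R\in A$, and $R(W_i)\subseteq W_i$ for all $i$; here $g\in G$ acts by $((W_i),R)\mapsto((gW_i),gRg^{-1})$. Let $\mathcal P_j^m$ be the set of partitions of $j$ all of whose parts are at most $m$. Then the number of $G^{(k)}$-orbits on $A^{(k)}_{\mathcal Y}$ equals $$\sum_{j=0}^{k} c(k-j,\mathcal Y)\sum_{\lambda\in\mathcal P_j^m}\xi_\lambda(G,A).$$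 -/

import Mathlib

universe u v

namespace QuiverCount

/-! ## Orbits -/

/-- `γ(H, X)`: the number of orbits of the subgroup `H` of `G` on the subset `X` of `Y`, for a
given action of `G` on `Y`. (For an `H`-stable `X` the `H`-orbits of the points of `X` are exactly
the `H`-orbits on `X`.) -/
noncomputable def orbitCount {G Y : Type*} [Group G] (act : MulAction G Y) (H : Subgroup G)
    (X : Set Y) : ℕ :=
  letI := act
  ((fun x : Y => MulAction.orbit H x) '' X).ncard

/-- The action of the units of a monoid on the monoid by conjugation, `g ∘ x = g x g⁻¹`. -/
@[reducible]
def conjAction (M : Type*) [Monoid M] : MulAction Mˣ M where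
  smul g x := (g : M) * x * ((g⁻¹ : Mˣ) : M)
  one_smul x := by
    change ((1 : Mˣ) : M) * x * (((1 : Mˣ)⁻¹ : Mˣ) : M) = x
    simp
  mul_smul g h x := by
    change ((g * h : Mˣ) : M) * x * (((g * h)⁻¹ : Mˣ) : M)
      = (g : M) * ((h : M) * x * ((h⁻¹ : Mˣ) : M)) * ((g⁻¹ : Mˣ) : M)
    simp [mul_assoc]

/-! ## Classes of endomorphisms -/

/-- `T` is a `𝒴`-endomorphism for the class `𝒴 = 𝒴_F` associated with a set `F` of elements of
the algebraic closure: all eigenvalues of `T` over the algebraic closure lie in `F`. -/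
def InClass {K : Type v} [Field K] (F : Set (AlgebraicClosure K))
    {U : Type*} [AddCommGroup U] [Module K U] (T : Module.End K U) : Prop :=
  ∀ x : AlgebraicClosure K,
    Module.End.HasEigenvalue (LinearMap.baseChange (AlgebraicClosure K) T) x → x ∈ F

/-- `c(n, 𝒴)`: the number of `GL_n(K)`-conjugacy classes of `𝒴`-endomorphisms of `Kⁿ`. -/
noncomputable def classNumber {K : Type v} [Field K] (F : Set (AlgebraicClosure K)) (n : ℕ) : ℕ :=
  orbitCount (conjAction (Module.End K (Fin n → K))) ⊤ {T | InClass F T}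

/-! ## Quiver representations -/

/-- A quiver with the finite sets `E₀` of nodes and `E₁` of arrows, together with a representation
of it over `K`. -/
structure QuiverRep (K : Type v) [Field K] (E₀ E₁ : Type) where
  finite_nodes : Finite E₀
  finite_arrows : Finite E₁
  /-- the source of an arrow -/
  src : E₁ → E₀
  /-- the target of an arrow -/
  tgt : E₁ → E₀
  /-- the vector spaces at the nodes -/
  U : E₀ → Type u
  [addCommGroup : ∀ a, AddCommGroup (U a)]
  [module : ∀ a, Module K (U a)]
  /-- the linear maps along the arrows -/
  α : ∀ e, U (src e) →ₗ[K] U (tgt e)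

namespace QuiverRep

attribute [instance] QuiverRep.addCommGroup QuiverRep.module

variable {K : Type v} [Field K] {E₀ E₁ : Type} (Q : QuiverRep.{u, v} K E₀ E₁)

/-- The ring `End(Q)`: tuples `(X_a)` of endomorphisms with `α_e X_{σ(e)} = X_{τ(e)} α_e`. -/
def endRing : Subring (∀ a, Module.End K (Q.U a)) where
  carrier := {X | ∀ e, (Q.α e).comp (X (Q.src e)) = (X (Q.tgt e)).comp (Q.α e)}
  zero_mem' e := by ext; simp
  one_mem' e := by ext; simp
  add_mem' {X Y} hX hY e := by
    have h₁ := hX e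
    have h₂ := hY e
    simp only [Pi.add_apply, LinearMap.comp_add, LinearMap.add_comp, h₁, h₂]
  neg_mem' {X} hX e := by
    have h₁ := hX e
    simp only [Pi.neg_apply, LinearMap.comp_neg, LinearMap.neg_comp, h₁]
  mul_mem' {X Y} hX hY e := by
    have h₁ := hX e
    have h₂ := hY e
    simp only [Pi.mul_apply, Module.End.mul_eq_comp]
    rw [← LinearMap.comp_assoc, h₁, LinearMap.comp_assoc, h₂, LinearMap.comp_assoc]

/-- The group `Aut(Q)`. -/
abbrev aut : Type _ := (Q.endRing)ˣ

/-- The projection `End(Q) → End(U_c)`, `X ↦ X_c`. Here `Q` is viewed as an extension of the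
representation which has the single node `c`, the space `U_c` there and no arrows. -/
def proj (c : E₀) : Q.endRing →+* Module.End K (Q.U c) :=
  (Pi.evalRingHom (fun a => Module.End K (Q.U a)) c).comp Q.endRing.subtype

/-- `G^Q = π⁻¹(G) ∩ Aut(Q)`, for a subgroup `G` of `GL(U_c)`. -/
def liftGroup (c : E₀) (G : Subgroup (LinearMap.GeneralLinearGroup K (Q.U c))) :
    Subgroup Q.aut :=
  G.comap (Units.map (Q.proj c : Q.endRing →* Module.End K (Q.U c)))

/-- `End_𝒴(Q)`: the endomorphisms `X` of `Q` such that every `X_a` is a `𝒴`-endomorphism. -/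
def classEnd (F : Set (AlgebraicClosure K)) : Set Q.endRing :=
  {X | ∀ a, InClass F ((X : ∀ a, Module.End K (Q.U a)) a)}

/-- `A^Q_𝒴 = π⁻¹(A) ∩ End_𝒴(Q)`, for a subset `A` of `End(U_c)`. -/
def liftSet (c : E₀) (F : Set (AlgebraicClosure K)) (A : Set (Module.End K (Q.U c))) :
    Set Q.endRing :=
  Q.proj c ⁻¹' A ∩ Q.classEnd F

end QuiverRep

/-- The nodes of the quiver `v → z → w`. -/
inductive Node : Type
  | v
  | z
  | w

/-- The arrows of the quiver `v → z → w`. -/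
inductive Arrow : Type
  | vz
  | zw

/-- The representation `V → Z → W` given by linear maps `ι : V → Z` and `p : Z → W`. -/
def sequenceRep {K : Type v} [Field K] {V Z W : Type u}
    [AddCommGroup V] [Module K V] [AddCommGroup Z] [Module K Z] [AddCommGroup W] [Module K W]
    (ι : V →ₗ[K] Z) (p : Z →ₗ[K] W) : QuiverRep.{u, v} K Node Arrow where
  finite_nodes := Finite.of_surjective (fun i : Fin 3 => ![Node.v, Node.z, Node.w] i)
    (fun a => by cases a; exacts [⟨0, rfl⟩, ⟨1, rfl⟩, ⟨2, rfl⟩])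
  finite_arrows := Finite.of_surjective (fun i : Fin 2 => ![Arrow.vz, Arrow.zw] i)
    (fun a => by cases a; exacts [⟨0, rfl⟩, ⟨1, rfl⟩])
  src | .vz => .v | .zw => .z
  tgt | .vz => .z | .zw => .w
  U | .v => V | .z => Z | .w => W
  addCommGroup
    | .v => (inferInstance : AddCommGroup V)
    | .z => (inferInstance : AddCommGroup Z)
    | .w => (inferInstance : AddCommGroup W)
  module
    | .v => (inferInstance : Module K V)
    | .z => (inferInstance : Module K Z)
    | .w => (inferInstance : Module K W)
  α
    | .vz => ι
    | .zw => p

/-! ## Flags -/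

section Flags

variable {K : Type v} [Field K] {W : Type u} [AddCommGroup W] [Module K W]

/-- The list `[W₁, …, W_s]` of subspaces of `W` is a flag of type `[l₁, …, l_s]`:
`W ≥ W₁ ≥ ⋯ ≥ W_s` and `dim W_i = l_i`. -/
def IsFlag (l : List ℕ) (fl : List (Submodule K W)) : Prop :=
  fl.Pairwise (fun U U' => U' ≤ U) ∧ fl.map (fun U : Submodule K W => Module.finrank K U) = l

/-- `GL(W)` acts on pairs (list of subspaces of `W`, endomorphism of `W`) by
`g ∘ ((W_i), R) = ((g W_i), g R g⁻¹)`. -/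
@[reducible]
def flagAction (K : Type v) [Field K] (W : Type u) [AddCommGroup W] [Module K W] :
    MulAction (LinearMap.GeneralLinearGroup K W) (List (Submodule K W) × Module.End K W) where
  smul g x := (x.1.map (Submodule.map (g : Module.End K W)),
    (g : Module.End K W) * x.2 * ((g⁻¹ : LinearMap.GeneralLinearGroup K W) : Module.End K W))
  one_smul x := by
    refine Prod.ext ?_ ((conjAction (Module.End K W)).one_smul x.2)
    change x.1.map (Submodule.map ((1 : LinearMap.GeneralLinearGroup K W) : Module.End K W)) = x.1
    have h : (Submodule.map (LinearMap.id : W →ₗ[K] W)) = id := funext Submodule.map_id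
    simp [Module.End.one_eq_id, h]
  mul_smul g h x := by
    refine Prod.ext ?_ ((conjAction (Module.End K W)).mul_smul g h x.2)
    change x.1.map (Submodule.map ((g * h : LinearMap.GeneralLinearGroup K W) : Module.End K W))
      = (x.1.map (Submodule.map (h : Module.End K W))).map (Submodule.map (g : Module.End K W))
    simp [Module.End.mul_eq_comp, Submodule.map_comp]

/-- `T_l(A)`: the pairs (flag `(W_i)` of type `l`, element `R` of `A`) with `R(W_i) ⊆ W_i` for
all `i`. -/
def flagPairs (l : List ℕ) (A : Set (Module.End K W)) :
    Set (List (Submodule K W) × Module.End K W) :=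
  {x | IsFlag l x.1 ∧ x.2 ∈ A ∧ ∀ U ∈ x.1, Submodule.map x.2 U ≤ U}

/-- `ξ_l(G, A) = γ(G, T_l(A))`. -/
noncomputable def xi (l : List ℕ) (G : Subgroup (LinearMap.GeneralLinearGroup K W))
    (A : Set (Module.End K W)) : ℕ :=
  orbitCount (flagAction K W) G (flagPairs l A)

end Flags

/-- `𝒫_j^m`: the partitions of `j` all of whose parts are at most `m`. -/
def boundedPartitions (j m : ℕ) : Finset (Nat.Partition j) :=
  Nat.Partition.restricted j (fun i => i ≤ m)

/-- The parts `λ₁ ≥ λ₂ ≥ ⋯` of a partition, in non-increasing order. -/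
def partsList {j : ℕ} (lam : Nat.Partition j) : List ℕ :=
  lam.parts.sort (fun a b => b ≤ a)

end QuiverCount

namespace QuiverCount

/-! ## Orbit counting -/

/-! Everything is a count of commuting pairs. By Burnside, the number of orbits times the order of
the lifted group is the number of commuting pairs (g, X) upstairs. These are grouped by their images
(h, R), the commuting pairs in G × A.

Fix (h, R) and a splitting of the sequence. A lift is a pair of block triangular matrices with
diagonals (g, h) and (T, R) and corners C and B. They commute iff g and T commute and gB + CR = TC +
Bh, which is linear in (C, B). The trace pairing identifies the cokernel of this system with the
dual of the space of maps f : V → W satisfying fT = Rf and fg = hf. Hence the number of lifts is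
|Hom(W, V)| times the number of triples (g, T, f) (`card_commutor_eq` below in the form
`card_commutator_eq`, and `card_commutingLifts`).

Now sort the triples on Kⁿ by the image U of f, an invariant subspace. For a given surjection f : Kⁿ
→ U, the pair (g, T) is a commuting lift of (h, R)|U, so the previous count applies again, with Kⁿ
in the middle and the kernel of f on the left. Let N(n, U) be the number of triples on Kⁿ with image
inside U. Division by |GL_n| absorbs the number of surjections and gives the recursion: N(n,
U)/|GL_n| is the sum of N(n − dim U₁, U₁)/|GL_{n − dim U₁}| over invariant U₁ ≤ U with dim U₁ ≤ n.
The term U₁ = 0 is c(n), by Burnside once more. Unrolling gives the sum over j of c(n − j) times the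
number of decreasing chains of non-zero invariant subspaces of total dimension j
(`card_mapsInto_div_eq_sum`).

The dimensions along such a chain form a partition of j. Summing over (h, R) and applying Burnside
to the action of G on flags turns the chain counts into |G| ξ_λ(G, A). -/

/-- Burnside's lemma for `orbitCount`. -/
theorem orbitCount_mul_card {G Y : Type*} [Group G] (act : MulAction G Y)
    (H : Subgroup G) (X : Set Y) (hX : ∀ g ∈ H, ∀ x ∈ X, act.smul g x ∈ X) :
    orbitCount act H X * Nat.card H =
      Nat.card {q : G × Y // q.1 ∈ H ∧ q.2 ∈ X ∧ act.smul q.1 q.2 = q.2} := by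
  let _ := act
  let S : SubMulAction H Y := ⟨X, fun g x hx => hX g.1 g.2 x hx⟩
  let e₁ : (Σ g : H, MulAction.fixedBy S g) ≃
      {q : G × Y // q.1 ∈ H ∧ q.2 ∈ X ∧ act.smul q.1 q.2 = q.2} :=
    { toFun := fun a => ⟨(a.1.1, a.2.1.1), a.1.2, a.2.1.2, congrArg Subtype.val a.2.2⟩
      invFun := fun q => ⟨⟨q.1.1, q.2.1⟩, ⟨⟨q.1.2, q.2.2.1⟩, Subtype.ext q.2.2.2⟩⟩
      left_inv := fun a => rfl
      right_inv := fun q => rfl }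
  rw [← Nat.card_congr e₁, Nat.card_congr (MulAction.sigmaFixedByEquivOrbitsProdGroup H S),
    Nat.card_prod]
  congr 1
  let φ : MulAction.orbitRel.Quotient H S → Set Y :=
    Quotient.lift (fun x : S => MulAction.orbit H (x : Y)) (by
      rintro a b ⟨g, hg⟩
      rw [MulAction.orbit_eq_iff]
      exact ⟨g, congrArg Subtype.val hg⟩)
  have hφ : Function.Injective φ := by
    intro a b
    induction a using Quotient.inductionOn with | _ a
    induction b using Quotient.inductionOn with | _ b
    intro h
    have h' : MulAction.orbit H (a : Y) = MulAction.orbit H (b : Y) := h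
    rw [MulAction.orbit_eq_iff] at h'
    obtain ⟨g, hg⟩ := h'
    exact Quotient.sound ⟨g, Subtype.ext hg⟩
  have hr : Set.range φ = (fun x : Y => MulAction.orbit H x) '' X := by
    ext s
    constructor
    · rintro ⟨a, rfl⟩
      induction a using Quotient.inductionOn with | _ a
      exact ⟨a.1, a.2, rfl⟩
    · rintro ⟨x, hx, rfl⟩
      exact ⟨Quotient.mk _ ⟨x, hx⟩, rfl⟩
  change ((fun x : Y => MulAction.orbit H x) '' X).ncard = _
  rw [← hr, ← Nat.card_coe_set_eq, Nat.card_congr (Equiv.ofInjective φ hφ).symm]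

/-! ## Eigenvalues and exact sequences -/

section InClass

variable {K : Type v} [Field K] {F : Set (AlgebraicClosure K)}
  {V Z W : Type*} [AddCommGroup V] [Module K V] [AddCommGroup Z] [Module K Z]
  [AddCommGroup W] [Module K W]

/-- In finite dimension, an eigenvalue of a quotient endomorphism lifts. -/
theorem hasEigenvalue_of_surjective {L : Type*} [Field L] {M N : Type*} [AddCommGroup M]
    [Module L M] [AddCommGroup N] [Module L N] [FiniteDimensional L M] [FiniteDimensional L N]
    {p : M →ₗ[L] N} (hp : Function.Surjective p) {T : Module.End L M} {R : Module.End L N}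
    (h : p ∘ₗ T = R ∘ₗ p) {x : L} (hx : R.HasEigenvalue x) : T.HasEigenvalue x := by
  rw [Module.End.hasEigenvalue_iff, Module.End.eigenspace_def] at hx ⊢
  intro hT
  apply hx
  -- In finite dimension injectivity of `T - x` is surjectivity, which passes to the quotient.
  rw [LinearMap.ker_eq_bot_iff_range_eq_top, LinearMap.range_eq_top] at hT ⊢
  intro y
  obtain ⟨z, rfl⟩ := hp y
  obtain ⟨z', rfl⟩ := hT z
  refine ⟨p z', ?_⟩
  have h' := LinearMap.congr_fun h z'
  simp only [LinearMap.comp_apply] at h'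
  simp [h']

theorem baseChange_intertwine {f : V →ₗ[K] Z} {S : Module.End K V} {T : Module.End K Z}
    (h : f ∘ₗ S = T ∘ₗ f) (L : Type*) [Field L] [Algebra K L] :
    f.baseChange L ∘ₗ S.baseChange L = T.baseChange L ∘ₗ f.baseChange L := by
  rw [← LinearMap.baseChange_comp, h, LinearMap.baseChange_comp]

theorem InClass.of_injective {ι : V →ₗ[K] Z} (hι : Function.Injective ι) {S : Module.End K V}
    {T : Module.End K Z} (h : ι ∘ₗ S = T ∘ₗ ι) (hT : InClass F T) : InClass F S := by
  intro x hx
  obtain ⟨v, hv⟩ := hx.exists_hasEigenvector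
  have hb : Function.Injective (ι.baseChange (AlgebraicClosure K)) :=
    Module.Flat.lTensor_preserves_injective_linearMap (M := AlgebraicClosure K) ι hι
  refine hT x (Module.End.hasEigenvalue_of_hasEigenvector
    (x := ι.baseChange (AlgebraicClosure K) v) ⟨?_, ?_⟩)
  · have h' := LinearMap.congr_fun (baseChange_intertwine h (AlgebraicClosure K)) v
    rw [LinearMap.comp_apply, LinearMap.comp_apply, hv.apply_eq_smul, map_smul] at h'
    exact Module.End.mem_eigenspace_iff.2 h'.symm
  · exact fun h0 => hv.2 (hb (by rw [h0, map_zero]))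

theorem InClass.of_surjective [FiniteDimensional K Z] [FiniteDimensional K W] {p : Z →ₗ[K] W}
    (hp : Function.Surjective p) {T : Module.End K Z} {R : Module.End K W}
    (h : p ∘ₗ T = R ∘ₗ p) (hT : InClass F T) : InClass F R := by
  intro x hx
  have hb : Function.Surjective (p.baseChange (AlgebraicClosure K)) :=
    LinearMap.lTensor_surjective (AlgebraicClosure K) hp
  exact hT x (hasEigenvalue_of_surjective hb
    (baseChange_intertwine h (AlgebraicClosure K)) hx)

/-- Base change keeps the sequence exact. An eigenvector of `T` either has non-zero image in the
quotient, an eigenvector of `R`, or comes from an eigenvector of `S`. -/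
theorem InClass.of_exact {ι : V →ₗ[K] Z} {p : Z →ₗ[K] W} (hι : Function.Injective ι)
    (hp : Function.Surjective p) (hex : Function.Exact ι p) {S : Module.End K V}
    {T : Module.End K Z} {R : Module.End K W} (hS : ι ∘ₗ S = T ∘ₗ ι) (hR : p ∘ₗ T = R ∘ₗ p)
    (hSF : InClass F S) (hRF : InClass F R) : InClass F T := by
  intro x hx
  obtain ⟨z, hz⟩ := hx.exists_hasEigenvector
  have hb : Function.Injective (ι.baseChange (AlgebraicClosure K)) :=
    Module.Flat.lTensor_preserves_injective_linearMap (M := AlgebraicClosure K) ι hι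
  have he : Function.Exact (ι.baseChange (AlgebraicClosure K))
      (p.baseChange (AlgebraicClosure K)) := lTensor_exact (AlgebraicClosure K) hex hp
  have h₁ := baseChange_intertwine hS (AlgebraicClosure K)
  have h₂ := LinearMap.congr_fun (baseChange_intertwine hR (AlgebraicClosure K)) z
  rw [LinearMap.comp_apply, LinearMap.comp_apply, hz.apply_eq_smul, map_smul] at h₂
  by_cases h0 : p.baseChange (AlgebraicClosure K) z = 0
  · obtain ⟨v, rfl⟩ := (he z).1 h0
    refine hSF x (Module.End.hasEigenvalue_of_hasEigenvector (x := v) ⟨?_, ?_⟩)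
    · refine Module.End.mem_eigenspace_iff.2 (hb ?_)
      have := LinearMap.congr_fun h₁ v
      rw [LinearMap.comp_apply, LinearMap.comp_apply, hz.apply_eq_smul] at this
      rw [this, map_smul]
    · rintro rfl
      exact hz.2 (map_zero _)
  · exact hRF x (Module.End.hasEigenvalue_of_hasEigenvector
      ⟨Module.End.mem_eigenspace_iff.2 h₂.symm, h0⟩)

end InClass

/-! ## Duality -/

section Duality

variable {K : Type v} [Field K]
  {V W : Type*} [AddCommGroup V] [Module K V] [AddCommGroup W] [Module K W]

/-- The trace pairing between `Hom(V, W)` and `Hom(W, V)`. -/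
noncomputable def tracePairing (K : Type v) [Field K] (V W : Type*) [AddCommGroup V] [Module K V]
    [AddCommGroup W] [Module K W] : (V →ₗ[K] W) →ₗ[K] Module.Dual K (W →ₗ[K] V) :=
  (LinearMap.llcomp K W V W).compr₂ (LinearMap.trace K W)

theorem tracePairing_apply (f : V →ₗ[K] W) (B : W →ₗ[K] V) :
    tracePairing K V W f B = LinearMap.trace K W (f ∘ₗ B) := rfl

theorem tracePairing_injective [FiniteDimensional K W] : Function.Injective (tracePairing K V W) := by
  rw [injective_iff_map_eq_zero]
  intro f hf
  ext v
  rw [LinearMap.zero_apply, ← Module.forall_dual_apply_eq_zero_iff K]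
  intro φ
  -- Rank one maps suffice to test: the trace against `w ↦ φ w • v` is `φ (f v)`.
  have h := LinearMap.congr_fun hf (φ.smulRight v)
  rw [tracePairing_apply] at h
  have h' : f ∘ₗ φ.smulRight v = φ.smulRight (f v) := by ext w; simp
  rw [h', LinearMap.trace_smulRight] at h
  simpa using h

/-- The left side is the kernel of a linear map `Φ : H × H → H` with `H = Hom(W, V)`. Under the
trace pairing the annihilator of its range is the space of maps `f` on the right. -/
theorem card_commutator_eq [Finite K] [FiniteDimensional K V] [FiniteDimensional K W] (g T : Module.End K V) (h R : Module.End K W) :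
    Nat.card {q : (W →ₗ[K] V) × (W →ₗ[K] V) //
        g ∘ₗ q.2 + q.1 ∘ₗ R = T ∘ₗ q.1 + q.2 ∘ₗ h} =
      Nat.card (W →ₗ[K] V) *
        Nat.card {f : V →ₗ[K] W // f ∘ₗ T = R ∘ₗ f ∧ f ∘ₗ g = h ∘ₗ f} := by
  let H := W →ₗ[K] V
  let Φ₁ : H →ₗ[K] H := LinearMap.lcomp K V R - LinearMap.llcomp K W V V T
  let Φ₂ : H →ₗ[K] H := LinearMap.llcomp K W V V g - LinearMap.lcomp K V h
  let Φ : H × H →ₗ[K] H := Φ₁.coprod Φ₂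
  let N : Submodule K (V →ₗ[K] W) :=
    (LinearMap.range Φ).dualAnnihilator.comap (tracePairing K V W)
  have hN : ∀ f, f ∈ N ↔ f ∘ₗ T = R ∘ₗ f ∧ f ∘ₗ g = h ∘ₗ f := by
    intro f
    -- The transpose of `Φ`, computed by cyclicity of the trace.
    have key : ∀ q : H × H, tracePairing K V W f (Φ q) =
        tracePairing K V W (R ∘ₗ f - f ∘ₗ T) q.1 + tracePairing K V W (f ∘ₗ g - h ∘ₗ f) q.2 := by
      intro q
      have e₁ : LinearMap.trace K W (f ∘ₗ q.1 ∘ₗ R) = LinearMap.trace K W (R ∘ₗ f ∘ₗ q.1) :=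
        LinearMap.trace_comp_comm' R (f ∘ₗ q.1)
      have e₂ : LinearMap.trace K W (f ∘ₗ q.2 ∘ₗ h) = LinearMap.trace K W (h ∘ₗ f ∘ₗ q.2) :=
        LinearMap.trace_comp_comm' h (f ∘ₗ q.2)
      have e₃ : Φ q = (q.1 ∘ₗ R - T ∘ₗ q.1) + (g ∘ₗ q.2 - q.2 ∘ₗ h) := rfl
      simp only [e₃, tracePairing_apply, map_add, map_sub, LinearMap.comp_assoc, e₁, e₂,
        LinearMap.sub_apply]
    rw [Submodule.mem_comap, Submodule.mem_dualAnnihilator]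
    constructor
    · intro hf
      constructor
      · have : tracePairing K V W (R ∘ₗ f - f ∘ₗ T) = 0 := by
          ext1 B
          have := hf _ ⟨(B, 0), rfl⟩
          rw [key] at this
          simpa using this
        exact (sub_eq_zero.1 (tracePairing_injective (this.trans (map_zero _).symm))).symm
      · have : tracePairing K V W (f ∘ₗ g - h ∘ₗ f) = 0 := by
          ext1 B
          have := hf _ ⟨(0, B), rfl⟩
          rw [key] at this
          simpa using this
        exact sub_eq_zero.1 (tracePairing_injective (this.trans (map_zero _).symm))
    · rintro ⟨h₁, h₂⟩ _ ⟨q, rfl⟩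
      rw [key, h₁, h₂]
      simp
  have hbij : Function.Bijective (tracePairing K V W) := by
    refine ⟨tracePairing_injective, ?_⟩
    refine (LinearMap.injective_iff_surjective_of_finrank_eq_finrank ?_).1 tracePairing_injective
    · rw [Subspace.dual_finrank_eq, Module.finrank_linearMap, Module.finrank_linearMap, mul_comm]
  have hcN : Module.finrank K N = Module.finrank K (LinearMap.range Φ).dualAnnihilator := by
    let e := LinearEquiv.ofBijective _ hbij
    have : N = (LinearMap.range Φ).dualAnnihilator.map (e.symm : _ →ₗ[K] _) :=
      Submodule.comap_equiv_eq_map_symm e _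
    rw [this]
    exact LinearEquiv.finrank_map_eq e.symm _
  have hk : Nat.card {q : H × H // g ∘ₗ q.2 + q.1 ∘ₗ R = T ∘ₗ q.1 + q.2 ∘ₗ h} =
      Nat.card (LinearMap.ker Φ) := by
    refine Nat.card_congr (Equiv.subtypeEquivRight fun q => ?_)
    have e₃ : Φ q = (q.1 ∘ₗ R - T ∘ₗ q.1) + (g ∘ₗ q.2 - q.2 ∘ₗ h) := rfl
    rw [LinearMap.mem_ker, e₃, ← sub_eq_zero]
    refine Eq.congr ?_ rfl
    abel
  have hn : Nat.card {f : V →ₗ[K] W // f ∘ₗ T = R ∘ₗ f ∧ f ∘ₗ g = h ∘ₗ f} = Nat.card N :=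
    Nat.card_congr (Equiv.subtypeEquivRight fun f => (hN f).symm)
  rw [hk, hn, Module.natCard_eq_pow_finrank (K := K) (V := LinearMap.ker Φ),
    Module.natCard_eq_pow_finrank (K := K) (V := W →ₗ[K] V),
    Module.natCard_eq_pow_finrank (K := K) (V := N), ← pow_add]
  congr 1
  -- dim ker Φ = 2 dim H − rank Φ, and dim N = dim H − rank Φ.
  have h1 := LinearMap.finrank_range_add_finrank_ker Φ
  have h2 := Subspace.finrank_add_finrank_dualAnnihilator_eq (LinearMap.range Φ)
  rw [Module.finrank_prod] at h1
  change _ = Module.finrank K H + _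
  omega

end Duality

/-! ## Lifting endomorphisms along a surjection -/

section Lifts

variable {K : Type v} [Field K]
  {V Z W : Type*} [AddCommGroup V] [Module K V] [AddCommGroup Z] [Module K Z]
  [AddCommGroup W] [Module K W]

theorem isUnit_end_iff_injective [FiniteDimensional K V] (T : Module.End K V) :
    IsUnit T ↔ Function.Injective T := by
  rw [Module.End.isUnit_iff]
  exact ⟨fun h => h.1, fun h => ⟨h, LinearMap.injective_iff_surjective.1 h⟩⟩

theorem isUnit_iff_of_exact [FiniteDimensional K V] [FiniteDimensional K Z]
    [FiniteDimensional K W] {ι : V →ₗ[K] Z} {p : Z →ₗ[K] W} (hι : Function.Injective ι)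
    (hex : Function.Exact ι p) {S : Module.End K V} {T : Module.End K Z} {R : Module.End K W}
    (hS : ι ∘ₗ S = T ∘ₗ ι) (hR : p ∘ₗ T = R ∘ₗ p) (hu : IsUnit R) : IsUnit T ↔ IsUnit S := by
  rw [isUnit_end_iff_injective T, isUnit_end_iff_injective S]
  rw [isUnit_end_iff_injective] at hu
  constructor
  · intro hT
    have : Function.Injective (ι ∘ₗ S) := by
      rw [hS]
      exact hT.comp hι
    exact Function.Injective.of_comp (f := ι) this
  · intro hSi
    rw [injective_iff_map_eq_zero]
    intro z hz
    have h₂ := LinearMap.congr_fun hR z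
    rw [LinearMap.comp_apply, LinearMap.comp_apply, hz, map_zero] at h₂
    obtain ⟨v, rfl⟩ := (hex z).1 (hu (h₂.symm.trans (map_zero _).symm))
    have h₁ := LinearMap.congr_fun hS v
    rw [LinearMap.comp_apply, LinearMap.comp_apply, hz] at h₁
    rw [hSi (hι (h₁.trans (map_zero _).symm) |>.trans (map_zero _).symm), map_zero]

/-- A splitting of the short exact sequence given by `ι` and `p`. -/
structure Splitting (ι : V →ₗ[K] Z) (p : Z →ₗ[K] W) where
  s : W →ₗ[K] Z
  r : Z →ₗ[K] V
  p_s : ∀ w, p (s w) = w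
  r_ι : ∀ v, r (ι v) = v
  r_s : ∀ w, r (s w) = 0
  p_ι : ∀ v, p (ι v) = 0
  sum_eq : ∀ z, ι (r z) + s (p z) = z

theorem Splitting.nonempty {ι : V →ₗ[K] Z} {p : Z →ₗ[K] W} (hι : Function.Injective ι)
    (hp : Function.Surjective p) (hex : Function.Exact ι p) : Nonempty (Splitting ι p) := by
  obtain ⟨s, hs⟩ := p.exists_rightInverse_of_surjective (LinearMap.range_eq_top.2 hp)
  obtain ⟨r, hr⟩ := ι.exists_leftInverse_of_injective (LinearMap.ker_eq_bot.2 hι)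
  have hs' : ∀ w, p (s w) = w := fun w => LinearMap.congr_fun hs w
  have hr' : ∀ v, r (ι v) = v := fun v => LinearMap.congr_fun hr v
  have h0 : ∀ v, p (ι v) = 0 := fun v => (hex _).2 ⟨v, rfl⟩
  -- An arbitrary retraction is corrected so as to vanish on the image of `s`.
  refine ⟨⟨s, r - r ∘ₗ s ∘ₗ p, hs', ?_, ?_, h0, ?_⟩⟩
  · intro v
    simp [hr', h0]
  · intro w
    simp [hs']
  · intro z
    obtain ⟨v, hv⟩ := (hex (z - s (p z))).1 (by simp [hs'])
    have : (r - r ∘ₗ s ∘ₗ p) z = r (z - s (p z)) := by simp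
    rw [this, ← hv, hr', hv]
    abel

namespace Splitting

variable {ι : V →ₗ[K] Z} {p : Z →ₗ[K] W} (σ : Splitting ι p)

/-- The endomorphism of `Z` with upper triangular block matrix `(T, B; 0, R)`. -/
def block (T : Module.End K V) (B : W →ₗ[K] V) (R : Module.End K W) : Module.End K Z :=
  ι ∘ₗ T ∘ₗ σ.r + ι ∘ₗ B ∘ₗ p + σ.s ∘ₗ R ∘ₗ p

theorem block_apply (T : Module.End K V) (B : W →ₗ[K] V) (R : Module.End K W) (z : Z) :
    σ.block T B R z = ι (T (σ.r z)) + ι (B (p z)) + σ.s (R (p z)) := rfl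

theorem p_comp_block (T : Module.End K V) (B : W →ₗ[K] V) (R : Module.End K W) :
    p ∘ₗ σ.block T B R = R ∘ₗ p := by
  ext z
  simp [block_apply, σ.p_ι, σ.p_s]

theorem block_comp_ι (T : Module.End K V) (B : W →ₗ[K] V) (R : Module.End K W) :
    ι ∘ₗ T = σ.block T B R ∘ₗ ι := by
  ext z
  simp [block_apply, σ.p_ι, σ.r_ι]

theorem block_mul (T T' : Module.End K V) (B B' : W →ₗ[K] V) (R R' : Module.End K W) :
    σ.block T B R * σ.block T' B' R' = σ.block (T * T') (T ∘ₗ B' + B ∘ₗ R') (R * R') := by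
  ext z
  simp [block_apply, σ.p_ι, σ.p_s, σ.r_ι, σ.r_s, add_assoc]

theorem r_block_ι (T : Module.End K V) (B : W →ₗ[K] V) (R : Module.End K W) :
    σ.r ∘ₗ σ.block T B R ∘ₗ ι = T := by
  ext v
  simp [block_apply, σ.p_ι, σ.r_ι]

theorem r_block_s (T : Module.End K V) (B : W →ₗ[K] V) (R : Module.End K W) :
    σ.r ∘ₗ σ.block T B R ∘ₗ σ.s = B := by
  ext v
  simp [block_apply, σ.p_s, σ.r_ι, σ.r_s]

theorem block_eq {X : Module.End K Z} {R : Module.End K W} (h : p ∘ₗ X = R ∘ₗ p) :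
    σ.block (σ.r ∘ₗ X ∘ₗ ι) (σ.r ∘ₗ X ∘ₗ σ.s) R = X := by
  ext z
  have hp : ∀ z, p (X z) = R (p z) := fun z => LinearMap.congr_fun h z
  have h₁ : X z = X (ι (σ.r z)) + X (σ.s (p z)) := by rw [← map_add, σ.sum_eq]
  have h₂ : X (ι (σ.r z)) = ι (σ.r (X (ι (σ.r z)))) := by
    conv_lhs => rw [← σ.sum_eq (X (ι (σ.r z)))]
    simp [hp, σ.p_ι]
  have h₃ : X (σ.s (p z)) = ι (σ.r (X (σ.s (p z)))) + σ.s (R (p z)) := by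
    conv_lhs => rw [← σ.sum_eq (X (σ.s (p z)))]
    simp [hp, σ.p_s]
  rw [block_apply, h₁, h₃, h₂]
  simp [add_assoc]

end Splitting

/-- Triples `((g, T), f)` with `g` an automorphism of `V` and `T` an endomorphism of `V` in the
given class which commute, and `f` a map from `(V, g, T)` to `(W, h, R)`. -/
def equivariantMaps (F : Set (AlgebraicClosure K)) (V : Type*) [AddCommGroup V] [Module K V]
    (h R : Module.End K W) : Set ((Module.End K V × Module.End K V) × (V →ₗ[K] W)) :=
  {x | (IsUnit x.1.1 ∧ InClass F x.1.2 ∧ x.1.1 * x.1.2 = x.1.2 * x.1.1) ∧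
    x.2 ∘ₗ x.1.2 = R ∘ₗ x.2 ∧ x.2 ∘ₗ x.1.1 = h ∘ₗ x.2}

/-- Commuting pairs `(g, T)`, with `g` an automorphism and `T` in the given class, which lift
the pair `(h, R)` along `p`. -/
def commutingLifts (F : Set (AlgebraicClosure K)) (p : Z →ₗ[K] W) (h R : Module.End K W) :
    Set (Module.End K Z × Module.End K Z) :=
  {q | (IsUnit q.1 ∧ InClass F q.2 ∧ q.1 * q.2 = q.2 * q.1) ∧
    p ∘ₗ q.2 = R ∘ₗ p ∧ p ∘ₗ q.1 = h ∘ₗ p}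

theorem finite_hom [Finite K] [FiniteDimensional K V] [FiniteDimensional K W] :
    Finite (V →ₗ[K] W) := Module.finite_of_finite K

variable {ι : V →ₗ[K] Z} {p : Z →ₗ[K] W} [FiniteDimensional K V]
  [FiniteDimensional K Z] [FiniteDimensional K W]

/-- In block form, invertibility and membership in the class depend only on the diagonal. For each
commuting pair on `V`, the corners solve the linear system of `card_commutator_eq`, so both sides
agree pair by pair. -/
theorem card_commutingLifts [Finite K] {F : Set (AlgebraicClosure K)} (hι : Function.Injective ι)
    (hp : Function.Surjective p) (hex : Function.Exact ι p)
    {h R : Module.End K W} (hh : IsUnit h) (hc : h * R = R * h) (hR : InClass F R) :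
    Nat.card (commutingLifts F p h R) =
      Nat.card (W →ₗ[K] V) * Nat.card (equivariantMaps F V h R) := by
  obtain ⟨σ⟩ := Splitting.nonempty hι hp hex
  let P : Module.End K V × Module.End K V → Prop :=
    fun c => IsUnit c.1 ∧ InClass F c.2 ∧ c.1 * c.2 = c.2 * c.1
  have hinj : ∀ {T T' : Module.End K V} {B B' : W →ₗ[K] V} {S S' : Module.End K W},
      σ.block T B S = σ.block T' B' S' → T = T' ∧ B = B' := by
    intro T T' B B' S S' heq
    exact ⟨by rw [← σ.r_block_ι T B S, heq, σ.r_block_ι],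
      by rw [← σ.r_block_s T B S, heq, σ.r_block_s]⟩
  have hmem : ∀ (c : Module.End K V × Module.End K V) (q : (W →ₗ[K] V) × (W →ₗ[K] V)),
      (σ.block c.1 q.1 h, σ.block c.2 q.2 R) ∈ commutingLifts F p h R ↔
        P c ∧ c.1 ∘ₗ q.2 + q.1 ∘ₗ R = c.2 ∘ₗ q.1 + q.2 ∘ₗ h := by
    intro c q
    have h₁ := isUnit_iff_of_exact hι hex (σ.block_comp_ι c.1 q.1 h) (σ.p_comp_block c.1 q.1 h) hh
    have h₂ : InClass F (σ.block c.2 q.2 R) ↔ InClass F c.2 :=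
      ⟨InClass.of_injective hι (σ.block_comp_ι c.2 q.2 R), fun h2 => InClass.of_exact hι hp hex
        (σ.block_comp_ι c.2 q.2 R) (σ.p_comp_block c.2 q.2 R) h2 hR⟩
    constructor
    · rintro ⟨⟨a1, a2, a3⟩, -⟩
      rw [σ.block_mul, σ.block_mul] at a3
      exact ⟨⟨h₁.1 a1, h₂.1 a2, (hinj a3).1⟩, (hinj a3).2⟩
    · rintro ⟨⟨a1, a2, a3⟩, a4⟩
      refine ⟨⟨h₁.2 a1, h₂.2 a2, ?_⟩, σ.p_comp_block _ _ _, σ.p_comp_block _ _ _⟩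
      change σ.block c.1 q.1 h * σ.block c.2 q.2 R = σ.block c.2 q.2 R * σ.block c.1 q.1 h
      rw [σ.block_mul, σ.block_mul, a3, a4, hc]
  let e₁ : (Σ c : {c // P c}, {q : (W →ₗ[K] V) × (W →ₗ[K] V) //
      c.1.1 ∘ₗ q.2 + q.1 ∘ₗ R = c.1.2 ∘ₗ q.1 + q.2 ∘ₗ h}) ≃ commutingLifts F p h R :=
    Equiv.ofBijective (fun a => ⟨(σ.block a.1.1.1 a.2.1.1 h, σ.block a.1.1.2 a.2.1.2 R),
      (hmem _ _).2 ⟨a.1.2, a.2.2⟩⟩) (by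
      constructor
      · rintro ⟨⟨⟨g, T⟩, hP⟩, ⟨⟨C, B⟩, hq⟩⟩ ⟨⟨⟨g', T'⟩, hP'⟩, ⟨⟨C', B'⟩, hq'⟩⟩ heq
        have heq' := congrArg Subtype.val heq
        obtain ⟨rfl, rfl⟩ := hinj (congrArg Prod.fst heq')
        obtain ⟨rfl, rfl⟩ := hinj (congrArg Prod.snd heq')
        rfl
      · rintro ⟨⟨g, T⟩, hq⟩
        have hg := σ.block_eq hq.2.2
        have hT := σ.block_eq hq.2.1
        have hq' := (hmem (_, _) (_, _)).1 (by rw [hg, hT]; exact hq)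
        exact ⟨⟨⟨_, hq'.1⟩, ⟨_, hq'.2⟩⟩, Subtype.ext (Prod.ext hg hT)⟩)
  let e₂ : (Σ c : {c // P c}, {f : V →ₗ[K] W // f ∘ₗ c.1.2 = R ∘ₗ f ∧ f ∘ₗ c.1.1 = h ∘ₗ f}) ≃
      equivariantMaps F V h R :=
    { toFun := fun a => ⟨(a.1.1, a.2.1), a.1.2, a.2.2⟩
      invFun := fun x => ⟨⟨x.1.1, x.2.1⟩, ⟨x.1.2, x.2.2⟩⟩
      left_inv := fun a => rfl
      right_inv := fun a => rfl }
  have := finite_hom (K := K) (V := V) (W := V)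
  have := finite_hom (K := K) (V := V) (W := W)
  have := finite_hom (K := K) (V := W) (W := V)
  let _ := Fintype.ofFinite {c // P c}
  rw [← Nat.card_congr e₁, ← Nat.card_congr e₂, Nat.card_sigma, Nat.card_sigma, Finset.mul_sum]
  exact Finset.sum_congr rfl fun c _ => card_commutator_eq c.1.1 c.1.2 h R

theorem card_unit_lifts (hι : Function.Injective ι)
    (hp : Function.Surjective p) (hex : Function.Exact ι p) {h : Module.End K W} (hh : IsUnit h) :
    Nat.card {g : Module.End K Z // IsUnit g ∧ p ∘ₗ g = h ∘ₗ p} =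
      Nat.card (Module.End K V)ˣ * Nat.card (W →ₗ[K] V) := by
  obtain ⟨σ⟩ := Splitting.nonempty hι hp hex
  rw [← Nat.card_prod]
  symm
  have hiff : ∀ T B, IsUnit (σ.block T B h) ↔ IsUnit T := fun T B =>
    isUnit_iff_of_exact hι hex (σ.block_comp_ι T B h) (σ.p_comp_block T B h) hh
  refine Nat.card_congr (Equiv.ofBijective (fun a => ⟨σ.block a.1 a.2 h,
    (hiff _ _).2 a.1.isUnit, σ.p_comp_block _ _ _⟩) ⟨?_, ?_⟩)
  · rintro ⟨T, B⟩ ⟨T', B'⟩ heq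
    have heq' : σ.block T B h = σ.block T' B' h := congrArg Subtype.val heq
    refine Prod.ext (Units.ext ?_) ?_
    · change (T : Module.End K V) = T'
      rw [← σ.r_block_ι T B h, heq', σ.r_block_ι]
    · change B = B'
      rw [← σ.r_block_s T B h, heq', σ.r_block_s]
  · rintro ⟨g, hg, hpg⟩
    have hb := σ.block_eq hpg
    have hT := (hiff (σ.r ∘ₗ g ∘ₗ ι) (σ.r ∘ₗ g ∘ₗ σ.s)).1 (by rw [hb]; exact hg)
    exact ⟨(hT.unit, σ.r ∘ₗ g ∘ₗ σ.s), Subtype.ext hb⟩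

/-- The number of surjections `Z → W` times the order of the stabiliser of one of them in `GL(Z)`
is the order of `GL(Z)`. -/
theorem card_surjective_mul [Finite K] (hι : Function.Injective ι)
    (hp : Function.Surjective p) (hex : Function.Exact ι p) :
    Nat.card {f : Z →ₗ[K] W // Function.Surjective f} *
      (Nat.card (Module.End K V)ˣ * Nat.card (W →ₗ[K] V)) = Nat.card (Module.End K Z)ˣ := by
  have := finite_hom (K := K) (V := Z) (W := Z)
  have := finite_hom (K := K) (V := Z) (W := W)
  have hu : ∀ g : (Module.End K Z)ˣ, Function.Bijective (g : Module.End K Z) := fun g =>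
    (Module.End.isUnit_iff _).1 g.isUnit
  let φ : (Module.End K Z)ˣ → {f : Z →ₗ[K] W // Function.Surjective f} :=
    fun g => ⟨p ∘ₗ (g : Module.End K Z), hp.comp (hu g).2⟩
  let _ := Fintype.ofFinite {f : Z →ₗ[K] W // Function.Surjective f}
  rw [← Nat.card_congr (Equiv.sigmaFiberEquiv φ), Nat.card_sigma]
  have hfib : ∀ f, Nat.card {g // φ g = f} =
      Nat.card (Module.End K V)ˣ * Nat.card (W →ₗ[K] V) := by
    rintro ⟨f, hf⟩
    obtain ⟨σ⟩ := Splitting.nonempty hι hp hex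
    obtain ⟨τ⟩ := Splitting.nonempty (LinearMap.ker f).injective_subtype hf
      (LinearMap.exact_subtype_ker_map f)
    have hk : Module.finrank K (LinearMap.ker f) = Module.finrank K V := by
      have h₁ := LinearMap.finrank_range_add_finrank_ker f
      have h₂ := LinearMap.finrank_range_add_finrank_ker p
      rw [LinearMap.range_eq_top.2 hf, finrank_top] at h₁
      rw [LinearMap.range_eq_top.2 hp, finrank_top, hex.linearMap_ker_eq,
        LinearMap.finrank_range_of_inj hι] at h₂
      omega
    let e := LinearEquiv.ofFinrankEq _ _ hk
    -- An automorphism with `p ∘ g₀ = f`, glued from an isomorphism of the kernels. Right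
    -- translation by its inverse carries the fibre over `f` to the stabiliser of `p`.
    let g₀ : Module.End K Z := ι ∘ₗ (e : _ →ₗ[K] V) ∘ₗ τ.r + σ.s ∘ₗ f
    have hpg : p ∘ₗ g₀ = f := by
      ext z
      simp [g₀, σ.p_ι, σ.p_s]
    have hg₀ : IsUnit g₀ := by
      rw [isUnit_end_iff_injective, injective_iff_map_eq_zero]
      intro z hz
      have hfz : f z = 0 := by rw [← hpg, LinearMap.comp_apply, hz, map_zero]
      have hz' : ι (e (τ.r z)) + σ.s (f z) = 0 := hz
      rw [hfz, map_zero, add_zero] at hz'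
      have hr : τ.r z = 0 := e.injective ((hι (hz'.trans (map_zero ι).symm)).trans (map_zero e).symm)
      rw [← τ.sum_eq z, hr, hfz, map_zero, map_zero, add_zero]
    rw [← card_unit_lifts hι hp hex (h := 1) isUnit_one]
    refine Nat.card_congr
      { toFun := fun g => ⟨(g.1 : Module.End K Z) * (hg₀.unit⁻¹ : (Module.End K Z)ˣ),
          (g.1 * hg₀.unit⁻¹).isUnit, ?_⟩
        invFun := fun g => ⟨g.2.1.unit * hg₀.unit, Subtype.ext ?_⟩
        left_inv := fun g => Subtype.ext (Units.ext ?_)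
        right_inv := fun g => Subtype.ext ?_ }
    · have hg : p ∘ₗ (g.1 : Module.End K Z) = f := congrArg Subtype.val g.2
      have h1 : g₀ ∘ₗ ((hg₀.unit⁻¹ : (Module.End K Z)ˣ) : Module.End K Z) = LinearMap.id :=
        hg₀.mul_val_inv
      rw [Module.End.mul_eq_comp, ← LinearMap.comp_assoc, hg]
      conv_lhs => rw [← hpg, LinearMap.comp_assoc, h1]
      rfl
    · change p ∘ₗ (g.1 ∘ₗ g₀) = f
      rw [← LinearMap.comp_assoc, g.2.2, ← hpg]
      rfl
    · change (g.1 : Module.End K Z) * (hg₀.unit⁻¹ : (Module.End K Z)ˣ) * hg₀.unit = g.1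
      rw [Units.inv_mul_cancel_right]
    · change g.1 * (hg₀.unit : Module.End K Z) * (hg₀.unit⁻¹ : (Module.End K Z)ˣ) = g.1
      rw [Units.mul_inv_cancel_right]
  rw [Finset.sum_congr rfl fun f _ => hfib f, Finset.sum_const, Finset.card_univ,
    Nat.card_eq_fintype_card, smul_eq_mul]

end Lifts

theorem natCard_subtype_and {α : Type*} (P : Prop) [Decidable P] (Q : α → Prop) :
    Nat.card {x // P ∧ Q x} = if P then Nat.card {x // Q x} else 0 := by
  split_ifs with h
  · simp [h]
  · simp [h]

/-! ### Equivariant maps sorted by image, and the recursion over invariant subspaces -/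

section Recursion

variable {K : Type v} [Field K] {W : Type*} [AddCommGroup W] [Module K W]

/-- `U` is invariant under `R` and `h`. -/
def IsInvariant (h R : Module.End K W) (U : Submodule K W) : Prop :=
  Submodule.map R U ≤ U ∧ Submodule.map h U ≤ U

theorem IsInvariant.bot (h R : Module.End K W) : IsInvariant h R ⊥ := by
  simp [IsInvariant]

/-- The elements of `equivariantMaps F (Fin n → K) h R` with image in `U`. -/
def mapsInto (F : Set (AlgebraicClosure K)) (h R : Module.End K W) (n : ℕ) (U : Submodule K W) :
    Set ((Module.End K (Fin n → K) × Module.End K (Fin n → K)) × ((Fin n → K) →ₗ[K] W)) :=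
  {x | x ∈ equivariantMaps F (Fin n → K) h R ∧ LinearMap.range x.2 ≤ U}

/-- The order of `GL_n(K)`. -/
noncomputable def cardGL (K : Type v) [Field K] (n : ℕ) : ℕ :=
  Nat.card (Module.End K (Fin n → K))ˣ

theorem cardGL_pos [Finite K] (n : ℕ) : 0 < cardGL K n := by
  have := finite_hom (K := K) (V := Fin n → K) (W := Fin n → K)
  exact Nat.card_pos

theorem range_isInvariant {F : Set (AlgebraicClosure K)} {h R : Module.End K W} {n : ℕ}
    {x : (Module.End K (Fin n → K) × Module.End K (Fin n → K)) × ((Fin n → K) →ₗ[K] W)}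
    (hx : x ∈ equivariantMaps F (Fin n → K) h R) : IsInvariant h R (LinearMap.range x.2) := by
  constructor
  · rw [← LinearMap.range_comp, ← hx.2.1]
    exact LinearMap.range_comp_le_range _ _
  · rw [← LinearMap.range_comp, ← hx.2.2]
    exact LinearMap.range_comp_le_range _ _

theorem comp_restrict_iff {V : Type*} [AddCommGroup V] [Module K V] {U : Submodule K W}
    (f : V →ₗ[K] U) (T : Module.End K V) (S : Module.End K W) (hS : ∀ w ∈ U, S w ∈ U) :
    f ∘ₗ T = S.restrict hS ∘ₗ f ↔ (U.subtype ∘ₗ f) ∘ₗ T = S ∘ₗ U.subtype ∘ₗ f := by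
  constructor
  · intro hf
    rw [LinearMap.comp_assoc, hf]
    rfl
  · intro hf
    exact LinearMap.ext fun v => Subtype.ext (LinearMap.congr_fun hf v)

theorem card_equivariantMaps_restrict {F : Set (AlgebraicClosure K)} {h R : Module.End K W}
    (n : ℕ) {U : Submodule K W} (hh : ∀ w ∈ U, h w ∈ U) (hR : ∀ w ∈ U, R w ∈ U) :
    Nat.card (equivariantMaps F (Fin n → K) (h.restrict hh) (R.restrict hR)) =
      Nat.card (mapsInto F h R n U) := by
  refine Nat.card_congr
    { toFun := fun x => ⟨(x.1.1, U.subtype ∘ₗ x.1.2), ⟨x.2.1, (comp_restrict_iff _ _ _ _).1 x.2.2.1,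
          (comp_restrict_iff _ _ _ _).1 x.2.2.2⟩, ?_⟩
      invFun := fun x => ⟨(x.1.1, x.1.2.codRestrict U fun v => x.2.2 ⟨v, rfl⟩), x.2.1.1,
          (comp_restrict_iff _ _ _ _).2 x.2.1.2.1, (comp_restrict_iff _ _ _ _).2 x.2.1.2.2⟩
      left_inv := fun x => rfl
      right_inv := fun x => rfl }
  rintro _ ⟨v, rfl⟩
  exact (x.1.2 v).2

/-- The map is forced to be zero, so what remains are the commuting pairs (g, T), counted by
Burnside for conjugation. This is the constant term of the recursion. -/
theorem card_mapsInto_bot_div [Finite K] {F : Set (AlgebraicClosure K)} (h R : Module.End K W) (n : ℕ) :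
    (Nat.card (mapsInto F h R n ⊥) : ℚ) / cardGL K n = classNumber F n := by
  have hpos : (cardGL K n : ℚ) ≠ 0 := Nat.cast_ne_zero.2 (cardGL_pos n).ne'
  rw [div_eq_iff hpos, ← Nat.cast_mul, Nat.cast_inj]
  have hfix : ∀ (g : (Module.End K (Fin n → K))ˣ) (T : Module.End K (Fin n → K)),
      (conjAction _).smul g T = T ↔ (g : Module.End K (Fin n → K)) * T = T * g := by
    intro g T
    change (g : Module.End K (Fin n → K)) * T * ((g⁻¹ : (Module.End K (Fin n → K))ˣ)) = T ↔ _
    rw [Units.mul_inv_eq_iff_eq_mul]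
  have hst : ∀ g ∈ (⊤ : Subgroup (Module.End K (Fin n → K))ˣ),
      ∀ T ∈ {T : Module.End K (Fin n → K) | InClass F T},
        (conjAction (Module.End K (Fin n → K))).smul g T ∈ {T | InClass F T} := by
    intro g _ T hT
    have hg := (Module.End.isUnit_iff _).1 g.isUnit
    refine InClass.of_surjective (p := (g : Module.End K (Fin n → K))) hg.2 ?_ hT
    change (g : Module.End K (Fin n → K)) * T =
      (g : Module.End K (Fin n → K)) * T * ((g⁻¹ : (Module.End K (Fin n → K))ˣ)) * g
    rw [Units.inv_mul_cancel_right]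
  have hB := orbitCount_mul_card (conjAction (Module.End K (Fin n → K))) ⊤
    {T | InClass F T} hst
  rw [Subgroup.card_top] at hB
  change _ = orbitCount _ _ _ * Nat.card _
  rw [hB]
  refine Nat.card_congr
    { toFun := fun x => ⟨(x.2.1.1.1.unit, x.1.1.2), trivial, x.2.1.1.2.1,
        (hfix _ _).2 x.2.1.1.2.2⟩
      invFun := fun q => ⟨((q.1.1, q.1.2), 0), ⟨⟨q.1.1.isUnit, q.2.2.1, (hfix _ _).1 q.2.2.2⟩,
        by simp⟩, by simp⟩
      left_inv := fun x => Subtype.ext (Prod.ext rfl ?_)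
      right_inv := fun q => Subtype.ext (Prod.ext (Units.ext rfl) rfl) }
  exact (LinearMap.range_eq_bot.1 (le_bot_iff.1 x.2.2)).symm

variable [Finite K] [FiniteDimensional K W] {F : Set (AlgebraicClosure K)}

/-- The triples whose map has image exactly `U`, counted by the kernel of the map. -/
theorem card_range_eq_mul {h R : Module.End K W} (hh : IsUnit h) (hc : h * R = R * h)
    (hRF : InClass F R) {n : ℕ} {U : Submodule K W} (hU : IsInvariant h R U)
    (hn : Module.finrank K U ≤ n) :
    Nat.card {x // x ∈ equivariantMaps F (Fin n → K) h R ∧ LinearMap.range x.2 = U} *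
        cardGL K (n - Module.finrank K U) =
      cardGL K n * Nat.card (mapsInto F h R (n - Module.finrank K U) U) := by
  have hhU : ∀ w ∈ U, h w ∈ U := fun w hw => hU.2 ⟨w, hw, rfl⟩
  have hRU : ∀ w ∈ U, R w ∈ U := fun w hw => hU.1 ⟨w, hw, rfl⟩
  let h' := h.restrict hhU
  let R' := R.restrict hRU
  have hh' : IsUnit h' := by
    rw [isUnit_end_iff_injective] at hh ⊢
    intro a b hab
    exact Subtype.ext (hh (congrArg Subtype.val hab))
  have hc' : h' * R' = R' * h' := by
    ext1 w
    exact Subtype.ext (LinearMap.congr_fun hc w)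
  have hRF' : InClass F R' :=
    InClass.of_injective (ι := U.subtype) U.injective_subtype (by ext; rfl) hRF
  set d := n - Module.finrank K U with hd
  have hker : ∀ f : (Fin n → K) →ₗ[K] U, Function.Surjective f →
      ∃ ι : (Fin d → K) →ₗ[K] (Fin n → K), Function.Injective ι ∧ Function.Exact ι f := by
    intro f hf
    have hk : Module.finrank K (Fin d → K) = Module.finrank K (LinearMap.ker f) := by
      have h₁ := LinearMap.finrank_range_add_finrank_ker f
      rw [LinearMap.range_eq_top.2 hf, finrank_top, Module.finrank_fin_fun] at h₁
      rw [Module.finrank_fin_fun]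
      omega
    let e := LinearEquiv.ofFinrankEq _ _ hk
    refine ⟨(LinearMap.ker f).subtype ∘ₗ (e : _ →ₗ[K] _),
      (LinearMap.ker f).injective_subtype.comp e.injective, ?_⟩
    rw [LinearMap.exact_iff, LinearMap.range_comp, LinearEquiv.range, Submodule.map_top,
      Submodule.range_subtype]
  have hfR : ∀ f : (Fin n → K) →ₗ[K] U, Function.Surjective f →
      LinearMap.range (U.subtype ∘ₗ f) = U := by
    intro f hf
    rw [LinearMap.range_comp, LinearMap.range_eq_top.2 hf, Submodule.map_top,
      Submodule.range_subtype]
  -- For a fixed surjection onto `U`, the pairs (g, T) making it equivariant are the commuting lifts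
  -- of the restricted pair.
  let e : (Σ f : {f : (Fin n → K) →ₗ[K] U // Function.Surjective f},
      commutingLifts F f.1 h' R') ≃
      {x // x ∈ equivariantMaps F (Fin n → K) h R ∧ LinearMap.range x.2 = U} :=
    { toFun := fun a => ⟨(a.2.1, U.subtype ∘ₗ a.1.1), ⟨a.2.2.1, (comp_restrict_iff _ _ _ _).1 a.2.2.2.1,
        (comp_restrict_iff _ _ _ _).1 a.2.2.2.2⟩, hfR _ a.1.2⟩
      invFun := fun x => ⟨⟨x.1.2.codRestrict U fun v => x.2.2.le ⟨v, rfl⟩, fun u => by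
          obtain ⟨v, hv⟩ := x.2.2.ge u.2
          exact ⟨v, Subtype.ext hv⟩⟩,
        ⟨x.1.1, x.2.1.1, (comp_restrict_iff _ _ _ _).2 x.2.1.2.1, (comp_restrict_iff _ _ _ _).2 x.2.1.2.2⟩⟩
      left_inv := fun x => rfl
      right_inv := fun x => rfl }
  have := finite_hom (K := K) (V := Fin n → K) (W := Fin n → K)
  have := finite_hom (K := K) (V := Fin n → K) (W := U)
  let _ := Fintype.ofFinite {f : (Fin n → K) →ₗ[K] U // Function.Surjective f}
  have hfib : ∀ f : {f : (Fin n → K) →ₗ[K] U // Function.Surjective f},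
      Nat.card (commutingLifts F f.1 h' R') =
        Nat.card (U →ₗ[K] (Fin d → K)) * Nat.card (mapsInto F h R d U) := by
    intro f
    obtain ⟨ι, hι, hex⟩ := hker f.1 f.2
    rw [card_commutingLifts hι f.2 hex hh' hc' hRF', card_equivariantMaps_restrict]
  -- The factor |Hom(U, K^d)| in this orbit-stabiliser count matches the one in `hfib`; this is why
  -- only general linear orders survive.
  have hsurj : Nat.card {f : (Fin n → K) →ₗ[K] U // Function.Surjective f} *
      (cardGL K d * Nat.card (U →ₗ[K] (Fin d → K))) = cardGL K n := by
    let e' : (Fin (Module.finrank K U) → K) ≃ₗ[K] U :=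
      LinearEquiv.ofFinrankEq _ _ (Module.finrank_fin_fun K)
    let r : (Fin n → K) →ₗ[K] U := e' ∘ₗ LinearMap.funLeft K K (Fin.castLE hn)
    have hrs : Function.Surjective r := e'.surjective.comp
      (LinearMap.funLeft_surjective_of_injective K K _ (Fin.castLE_injective hn))
    obtain ⟨ι, hι, hex⟩ := hker r hrs
    exact card_surjective_mul hι hrs hex
  rw [← Nat.card_congr e, Nat.card_sigma, Finset.sum_congr rfl fun f _ => hfib f,
    Finset.sum_const, Finset.card_univ, ← Nat.card_eq_fintype_card, smul_eq_mul, ← hsurj]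
  ring

theorem finite_submodule : Finite (Submodule K W) := by
  have : Finite W := Module.finite_of_finite K
  exact Finite.of_injective (fun U : Submodule K W => (U : Set W)) SetLike.coe_injective

-- The set is fibred by the exact image `U₁`. Subspaces failing the condition have empty fibre,
-- since an image is invariant and of dimension at most `n`.
open Classical in
theorem card_mapsInto_div [Fintype (Submodule K W)] {h R : Module.End K W} (hh : IsUnit h)
    (hc : h * R = R * h) (hRF : InClass F R) (n : ℕ) (U : Submodule K W) :
    (Nat.card (mapsInto F h R n U) : ℚ) / cardGL K n =
      ∑ U₁ : Submodule K W, if U₁ ≤ U ∧ IsInvariant h R U₁ ∧ Module.finrank K U₁ ≤ n then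
        (Nat.card (mapsInto F h R (n - Module.finrank K U₁) U₁) : ℚ) /
          cardGL K (n - Module.finrank K U₁) else 0 := by
  have := finite_hom (K := K) (V := Fin n → K) (W := Fin n → K)
  have := finite_hom (K := K) (V := Fin n → K) (W := W)
  rw [← Nat.card_congr (Equiv.sigmaFiberEquiv fun x : mapsInto F h R n U =>
    LinearMap.range x.1.2), Nat.card_sigma, Nat.cast_sum, Finset.sum_div]
  refine Finset.sum_congr rfl fun U₁ _ => ?_
  have hpos : (cardGL K n : ℚ) ≠ 0 := Nat.cast_ne_zero.2 (cardGL_pos n).ne'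
  split_ifs with hU
  · have hpos' : (cardGL K (n - Module.finrank K U₁) : ℚ) ≠ 0 :=
      Nat.cast_ne_zero.2 (cardGL_pos _).ne'
    rw [div_eq_div_iff hpos hpos', mul_comm _ (cardGL K n : ℚ)]
    have := card_range_eq_mul hh hc hRF hU.2.1 hU.2.2
    rw [← Nat.cast_mul, ← Nat.cast_mul, ← this, Nat.cast_inj]
    congr 1
    exact Nat.card_congr
      { toFun := fun x => ⟨x.1.1, x.1.2.1, x.2⟩
        invFun := fun x => ⟨⟨x.1, x.2.1, x.2.2.le.trans hU.1⟩, x.2.2⟩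
        left_inv := fun x => rfl
        right_inv := fun x => rfl }
  · have : IsEmpty {x : mapsInto F h R n U // LinearMap.range x.1.2 = U₁} := by
      refine ⟨fun x => hU ?_⟩
      obtain ⟨⟨x, hx, hxU⟩, rfl⟩ := x
      refine ⟨hxU, range_isInvariant hx, ?_⟩
      exact (LinearMap.finrank_range_le x.2).trans (Module.finrank_fin_fun K).le
    rw [Nat.card_of_isEmpty, Nat.cast_zero, zero_div]

/-- Decreasing lists of non-zero invariant subspaces of `U` with total dimension `j`. -/
def invariantFlags (h R : Module.End K W) (j : ℕ) (U : Submodule K W) :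
    Set (List (Submodule K W)) :=
  {fl | fl.Pairwise (fun X X' => X' ≤ X) ∧
    (∀ X ∈ fl, X ≠ ⊥ ∧ X ≤ U ∧ IsInvariant h R X) ∧
    (fl.map fun X : Submodule K W => Module.finrank K X).sum = j}

theorem finite_invariantFlags (h R : Module.End K W) (j : ℕ) (U : Submodule K W) :
    (invariantFlags h R j U).Finite := by
  have := finite_submodule (K := K) (W := W)
  refine (List.finite_length_le (Submodule K W) j).subset fun fl hfl => ?_
  obtain ⟨-, h₂, rfl⟩ := hfl
  -- Members are non-zero, so each contributes at least 1 to `j` and the length is at most `j`.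
  have := List.card_nsmul_le_sum (fl.map fun X : Submodule K W => Module.finrank K X) 1 (by
    intro x hx
    obtain ⟨X, hX, rfl⟩ := List.mem_map.1 hx
    exact Submodule.one_le_finrank_iff.2 (h₂ X hX).1)
  simpa using this

-- Removing the largest subspace `U₁` of a chain leaves a chain inside `U₁`; the empty chain
-- accounts for `j = 0`. This mirrors the recursion of `card_mapsInto_div`.
open Classical in
theorem card_invariantFlags [Fintype (Submodule K W)] (h R : Module.End K W) (j : ℕ)
    (U : Submodule K W) :
    Nat.card (invariantFlags h R j U) = (if j = 0 then 1 else 0) +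
      ∑ U₁ : Submodule K W,
        if U₁ ≠ ⊥ ∧ U₁ ≤ U ∧ IsInvariant h R U₁ ∧ Module.finrank K U₁ ≤ j then
          Nat.card (invariantFlags h R (j - Module.finrank K U₁) U₁) else 0 := by
  let P : Submodule K W → Prop := fun U₁ =>
    U₁ ≠ ⊥ ∧ U₁ ≤ U ∧ IsInvariant h R U₁ ∧ Module.finrank K U₁ ≤ j
  have hcons : ∀ U₁ fl, U₁ :: fl ∈ invariantFlags h R j U ↔
      P U₁ ∧ fl ∈ invariantFlags h R (j - Module.finrank K U₁) U₁ := by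
    intro U₁ fl
    simp only [invariantFlags, Set.mem_ofPred_eq, List.pairwise_cons, List.map_cons, List.sum_cons,
      List.mem_cons, forall_eq_or_imp, P]
    constructor
    · rintro ⟨⟨a1, a2⟩, ⟨⟨a3, a4, a5⟩, a6⟩, a7⟩
      exact ⟨⟨a3, a4, a5, by omega⟩, a2, fun X hX => ⟨(a6 X hX).1, a1 X hX, (a6 X hX).2.2⟩,
        by omega⟩
    · rintro ⟨⟨a3, a4, a5, a8⟩, a2, a6, a7⟩
      exact ⟨⟨fun X hX => (a6 X hX).2.1, a2⟩, ⟨⟨a3, a4, a5⟩, fun X hX =>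
        ⟨(a6 X hX).1, (a6 X hX).2.1.trans a4, (a6 X hX).2.2⟩⟩, by omega⟩
  have hnil : [] ∈ invariantFlags h R j U ↔ j = 0 := by
    simp [invariantFlags, eq_comm]
  let e : {_u : Unit // j = 0} ⊕ (Σ U₁ : Submodule K W,
      {fl // P U₁ ∧ fl ∈ invariantFlags h R (j - Module.finrank K U₁) U₁}) ≃
      invariantFlags h R j U :=
    { toFun := Sum.elim (fun u => ⟨[], hnil.2 u.2⟩) fun a => ⟨a.1 :: a.2.1, (hcons _ _).2 a.2.2⟩
      invFun := fun fl => match fl with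
        | ⟨[], hfl⟩ => Sum.inl ⟨(), hnil.1 hfl⟩
        | ⟨U₁ :: fl, hfl⟩ => Sum.inr ⟨U₁, fl, (hcons _ _).1 hfl⟩
      left_inv := by rintro (_ | _) <;> rfl
      right_inv := by rintro ⟨_ | _, _⟩ <;> rfl }
  have : ∀ U₁ : Submodule K W,
      Finite {fl // P U₁ ∧ fl ∈ invariantFlags h R (j - Module.finrank K U₁) U₁} := fun U₁ =>
    ((finite_invariantFlags h R _ U₁).subset fun fl hfl => hfl.2).to_subtype
  rw [← Nat.card_congr e, Nat.card_sum, Nat.card_sigma]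
  congr 1
  · split_ifs with hj <;> simp [hj]
  · exact Finset.sum_congr rfl fun U₁ _ => natCard_subtype_and _ _

theorem sum_range_shift (a b : ℕ → ℚ) {l n : ℕ} (hl : l ≤ n) :
    (∑ j ∈ Finset.range (n + 1), if l ≤ j then a (n - j) * b (j - l) else 0) =
      ∑ i ∈ Finset.range (n - l + 1), a (n - l - i) * b i := by
  rw [← Finset.sum_filter]
  refine Finset.sum_nbij' (fun j => j - l) (fun i => i + l) ?_ ?_ ?_ ?_ ?_
  · intro j hj
    simp only [Finset.mem_filter, Finset.mem_range] at hj ⊢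
    omega
  · intro j hj
    simp only [Finset.mem_filter, Finset.mem_range] at hj ⊢
    omega
  · intro j hj
    simp only [Finset.mem_filter, Finset.mem_range] at hj
    omega
  · intro j hj
    omega
  · intro j hj
    simp only [Finset.mem_filter, Finset.mem_range] at hj
    rw [show n - l - (j - l) = n - j by omega]

/-- Both sides satisfy the same recursion. Strong induction on `n` applies because a non-zero `U₁`
lowers `n` by at least 1; the term `U₁ = ⊥` does not lower it and is evaluated directly. -/
theorem card_mapsInto_div_eq_sum {h R : Module.End K W} (hh : IsUnit h) (hc : h * R = R * h)
    (hRF : InClass F R) (n : ℕ) (U : Submodule K W) :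
    (Nat.card (mapsInto F h R n U) : ℚ) / cardGL K n =
      ∑ j ∈ Finset.range (n + 1),
        (classNumber F (n - j) : ℚ) * Nat.card (invariantFlags h R j U) := by
  classical
  have := finite_submodule (K := K) (W := W)
  let _ := Fintype.ofFinite (Submodule K W)
  induction n using Nat.strong_induction_on generalizing U with | _ n ih
  have hsplit : ∀ U₁ : Submodule K W,
      (if U₁ ≤ U ∧ IsInvariant h R U₁ ∧ Module.finrank K U₁ ≤ n then
        (Nat.card (mapsInto F h R (n - Module.finrank K U₁) U₁) : ℚ) /
          cardGL K (n - Module.finrank K U₁) else 0) =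
      (if U₁ = ⊥ then (classNumber F n : ℚ) else 0) +
        ∑ j ∈ Finset.range (n + 1), (classNumber F (n - j) : ℚ) *
          if U₁ ≠ ⊥ ∧ U₁ ≤ U ∧ IsInvariant h R U₁ ∧ Module.finrank K U₁ ≤ j then
            (Nat.card (invariantFlags h R (j - Module.finrank K U₁) U₁) : ℚ) else 0 := by
    intro U₁
    by_cases hb : U₁ = ⊥
    · subst hb
      rw [if_pos ⟨bot_le, IsInvariant.bot h R, by simp⟩, finrank_bot, Nat.sub_zero,
        card_mapsInto_bot_div]
      simp
    by_cases hg : U₁ ≤ U ∧ IsInvariant h R U₁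
    · have hpos : 1 ≤ Module.finrank K U₁ := Submodule.one_le_finrank_iff.2 hb
      by_cases hn : Module.finrank K U₁ ≤ n
      · have hs := sum_range_shift (fun i => (classNumber F i : ℚ))
          (fun i => (Nat.card (invariantFlags h R i U₁) : ℚ)) hn
        rw [if_pos ⟨hg.1, hg.2, hn⟩, ih _ (by omega), if_neg hb, zero_add, ← hs]
        refine Finset.sum_congr rfl fun j _ => ?_
        simp [hb, hg]
      · rw [if_neg (fun hx => hn hx.2.2), if_neg hb, zero_add, Finset.sum_eq_zero]
        intro j hj
        rw [if_neg, mul_zero]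
        rintro ⟨-, -, -, hx⟩
        have := Finset.mem_range.1 hj
        omega
    · rw [if_neg (fun hx => hg ⟨hx.1, hx.2.1⟩), if_neg hb, zero_add, Finset.sum_eq_zero]
      intro j hj
      rw [if_neg (fun hx => hg ⟨hx.2.1, hx.2.2.1⟩), mul_zero]
  rw [card_mapsInto_div hh hc hRF, Finset.sum_congr rfl fun U₁ _ => hsplit U₁,
    Finset.sum_add_distrib, Finset.sum_ite_eq' Finset.univ (⊥ : Submodule K W),
    if_pos (Finset.mem_univ _), Finset.sum_comm]
  have hflags : ∀ j, (Nat.card (invariantFlags h R j U) : ℚ) = (if j = 0 then 1 else 0) +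
      ∑ U₁ : Submodule K W,
        if U₁ ≠ ⊥ ∧ U₁ ≤ U ∧ IsInvariant h R U₁ ∧ Module.finrank K U₁ ≤ j then
          (Nat.card (invariantFlags h R (j - Module.finrank K U₁) U₁) : ℚ) else 0 := by
    intro j
    rw [card_invariantFlags]
    push_cast
    rfl
  simp only [hflags, mul_add, Finset.sum_add_distrib, Finset.mul_sum]
  congr 1
  simp

end Recursion

/-! ### Chains of invariant subspaces, partitions and flag orbits -/

section FlagCount

variable {K : Type v} [Field K] {W : Type u} [AddCommGroup W] [Module K W]

theorem coe_partsList {j : ℕ} (lam : Nat.Partition j) : (partsList lam : Multiset ℕ) = lam.parts :=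
  Multiset.sort_eq _ _

theorem partsList_eq {j : ℕ} {lam : Nat.Partition j} {l : List ℕ}
    (hl : l.Pairwise fun a b => b ≤ a) (h : lam.parts = l) : partsList lam = l := by
  rw [partsList, h, Multiset.coe_sort]
  exact List.mergeSort_eq_self (fun a b : ℕ => b ≤ a) hl

/-- The invariant flags of type `l`. -/
def invariantFlagsOfType (h R : Module.End K W) (l : List ℕ) : Set (List (Submodule K W)) :=
  {fl | IsFlag l fl ∧ ∀ U ∈ fl, IsInvariant h R U}

theorem invariantFlagsOfType_subset (h R : Module.End K W) {j : ℕ} (lam : Nat.Partition j) :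
    invariantFlagsOfType h R (partsList lam) ⊆ invariantFlags h R j ⊤ := by
  rintro fl ⟨⟨h₁, h₂⟩, h₃⟩
  refine ⟨h₁, fun X hX => ⟨?_, le_top, h₃ X hX⟩, ?_⟩
  · rintro rfl
    have hm : Module.finrank K (⊥ : Submodule K W) ∈ (partsList lam : Multiset ℕ) := by
      rw [← h₂]
      exact Multiset.mem_coe.2 (List.mem_map.2 ⟨_, hX, rfl⟩)
    rw [coe_partsList, finrank_bot] at hm
    exact absurd (lam.parts_pos hm) (lt_irrefl 0)
  · rw [h₂, ← Multiset.sum_coe, coe_partsList, lam.parts_sum]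

/-- The dimensions along a chain are positive, non-increasing and at most dim W, so each chain has
exactly one type among these partitions. -/
theorem sum_card_invariantFlagsOfType [Finite K] [FiniteDimensional K W] (h R : Module.End K W) (j : ℕ) :
    ∑ lam ∈ boundedPartitions j (Module.finrank K W),
      Nat.card (invariantFlagsOfType h R (partsList lam)) =
      Nat.card (invariantFlags h R j ⊤) := by
  have : ∀ lam : boundedPartitions j (Module.finrank K W),
      Finite (invariantFlagsOfType h R (partsList lam.1)) := fun lam =>
    ((finite_invariantFlags h R j ⊤).subset (invariantFlagsOfType_subset h R lam.1)).to_subtype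
  rw [← Finset.sum_coe_sort, ← Nat.card_sigma]
  refine Nat.card_congr (Equiv.ofBijective
    (fun a => ⟨a.2.1, invariantFlagsOfType_subset h R a.1.1 a.2.2⟩) ⟨?_, ?_⟩)
  · rintro ⟨⟨lam, hlam⟩, ⟨fl, hfl⟩⟩ ⟨⟨lam', hlam'⟩, ⟨fl', hfl'⟩⟩ heq
    obtain rfl : fl = fl' := congrArg Subtype.val heq
    obtain rfl : lam = lam' := by
      refine Nat.Partition.ext ?_
      rw [← coe_partsList lam, ← coe_partsList lam', ← hfl.1.2, ← hfl'.1.2]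
    rfl
  · rintro ⟨fl, h₁, h₂, h₃⟩
    let lam : Nat.Partition j :=
      { parts := (fl.map fun X : Submodule K W => Module.finrank K X : List ℕ)
        parts_pos := by
          intro i hi
          obtain ⟨X, hX, rfl⟩ := List.mem_map.1 (Multiset.mem_coe.1 hi)
          exact Submodule.one_le_finrank_iff.2 (h₂ X hX).1
        parts_sum := by rw [Multiset.sum_coe, h₃] }
    have hlam : lam ∈ boundedPartitions j (Module.finrank K W) := by
      refine Finset.mem_filter.2 ⟨Finset.mem_univ _, fun i hi => ?_⟩
      obtain ⟨X, hX, rfl⟩ := List.mem_map.1 (Multiset.mem_coe.1 hi)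
      exact Submodule.finrank_le X
    have hs : partsList lam = fl.map fun X : Submodule K W => Module.finrank K X :=
      partsList_eq (List.pairwise_map.2 (h₁.imp fun hX => Submodule.finrank_mono hX)) rfl
    exact ⟨⟨⟨lam, hlam⟩, fl, ⟨h₁, hs.symm⟩, fun X hX => (h₂ X hX).2.2⟩, rfl⟩

/-- The commuting pairs in `G × A`. -/
def commutingPairs (G : Subgroup (LinearMap.GeneralLinearGroup K W))
    (A : Set (Module.End K W)) : Set (LinearMap.GeneralLinearGroup K W × Module.End K W) :=
  {c | c.1 ∈ G ∧ c.2 ∈ A ∧ (c.1 : Module.End K W) * c.2 = c.2 * c.1}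

theorem map_eq_iff_map_le [FiniteDimensional K W] (g : LinearMap.GeneralLinearGroup K W) (U : Submodule K W) :
    Submodule.map (g : Module.End K W) U = U ↔ Submodule.map (g : Module.End K W) U ≤ U := by
  refine ⟨fun h => h.le, fun h => Submodule.eq_of_le_of_finrank_eq h ?_⟩
  exact (Submodule.equivMapOfInjective (g : Module.End K W)
    ((Module.End.isUnit_iff _).1 g.isUnit).1 U).finrank_eq.symm

/-- Identifies the fixed points for Burnside: `g` is injective, so stabilising a subspace is the
same as mapping it into itself. -/
theorem flagAction_smul_eq_iff [FiniteDimensional K W]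
    (g : LinearMap.GeneralLinearGroup K W) (x : List (Submodule K W) × Module.End K W) :
    (flagAction K W).smul g x = x ↔
      (∀ U ∈ x.1, Submodule.map (g : Module.End K W) U ≤ U) ∧
        (g : Module.End K W) * x.2 = x.2 * g := by
  have h₁ : (flagAction K W).smul g x = (x.1.map (Submodule.map (g : Module.End K W)),
    (g : Module.End K W) * x.2 * ((g⁻¹ : LinearMap.GeneralLinearGroup K W) : Module.End K W)) := rfl
  rw [h₁, Prod.ext_iff, Units.mul_inv_eq_iff_eq_mul]
  refine and_congr ?_ Iff.rfl
  conv_lhs => rw [← List.map_id x.1]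
  rw [List.map_map, List.map_inj_left]
  exact forall₂_congr fun U _ => map_eq_iff_map_le g U

theorem finite_end_units [Finite K] [FiniteDimensional K W] :
    Finite (LinearMap.GeneralLinearGroup K W) := by
  have := finite_hom (K := K) (V := W) (W := W)
  infer_instance

/-- Burnside for `flagAction`, with the fixed triples (g, flag, R) regrouped by the commuting pair
(g, R). -/
theorem xi_mul_card [Finite K] [FiniteDimensional K W] {G : Subgroup (LinearMap.GeneralLinearGroup K W)}
    {A : Set (Module.End K W)} (hGA : ∀ g ∈ G, ∀ T ∈ A, (g : Module.End K W) * T *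
      ((g⁻¹ : LinearMap.GeneralLinearGroup K W) : Module.End K W) ∈ A)
    [Fintype (commutingPairs G A)] {j : ℕ} (lam : Nat.Partition j) :
    xi (partsList lam) G A * Nat.card G = ∑ c : commutingPairs G A,
      Nat.card (invariantFlagsOfType (c.1.1 : Module.End K W) c.1.2 (partsList lam)) := by
  have hst : ∀ g ∈ G, ∀ x ∈ flagPairs (partsList lam) A,
      (flagAction K W).smul g x ∈ flagPairs (partsList lam) A := by
    rintro g hg ⟨fl, R⟩ ⟨⟨h₁, h₂⟩, h₃, h₄⟩
    have hinj := ((Module.End.isUnit_iff _).1 g.isUnit).1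
    refine ⟨⟨?_, ?_⟩, hGA g hg R h₃, ?_⟩
    · exact List.pairwise_map.2 (h₁.imp fun hX => Submodule.map_mono hX)
    · rw [← h₂]
      change (fl.map (Submodule.map (g : Module.End K W))).map _ = _
      rw [List.map_map]
      exact List.map_congr_left fun U _ =>
        (Submodule.equivMapOfInjective (g : Module.End K W) hinj U).finrank_eq.symm
    · intro U hU
      obtain ⟨X, hX, rfl⟩ := List.mem_map.1 hU
      change Submodule.map ((g : Module.End K W) * R *
        ((g⁻¹ : LinearMap.GeneralLinearGroup K W) : Module.End K W)) _ ≤ _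
      rw [← Submodule.map_comp]
      change Submodule.map ((g : Module.End K W) * R *
        ((g⁻¹ : LinearMap.GeneralLinearGroup K W) : Module.End K W) * (g : Module.End K W)) _ ≤ _
      rw [Units.inv_mul_cancel_right, Module.End.mul_eq_comp, Submodule.map_comp]
      exact Submodule.map_mono (h₄ X hX)
  have := finite_end_units (K := K) (W := W)
  have : ∀ c : commutingPairs G A, Finite
      (invariantFlagsOfType (c.1.1 : Module.End K W) c.1.2 (partsList lam)) := fun c =>
    ((finite_invariantFlags _ _ j ⊤).subset (invariantFlagsOfType_subset _ _ lam)).to_subtype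
  rw [xi, orbitCount_mul_card _ _ _ hst, ← Nat.card_sigma]
  exact Nat.card_congr
    { toFun := fun q => ⟨⟨(q.1.1, q.1.2.2), q.2.1, q.2.2.1.2.1,
          ((flagAction_smul_eq_iff _ _).1 q.2.2.2).2⟩,
        ⟨q.1.2.1, q.2.2.1.1, fun U hU => ⟨q.2.2.1.2.2 U hU,
          ((flagAction_smul_eq_iff _ _).1 q.2.2.2).1 U hU⟩⟩⟩
      invFun := fun a => ⟨(a.1.1.1, (a.2.1, a.1.1.2)), a.1.2.1,
        ⟨a.2.2.1, a.1.2.2.1, fun U hU => (a.2.2.2 U hU).1⟩,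
        (flagAction_smul_eq_iff _ _).2 ⟨fun U hU => (a.2.2.2 U hU).2, a.1.2.2.2⟩⟩
      left_inv := fun q => rfl
      right_inv := fun a => rfl }

end FlagCount

/-! ## Endomorphisms of a short exact sequence -/

section SequenceRep

variable {K : Type v} [Field K] {V Z W : Type u} [AddCommGroup V] [Module K V] [AddCommGroup Z]
  [Module K Z] [AddCommGroup W] [Module K W] {ι : V →ₗ[K] Z} {p : Z →ₗ[K] W}

/-- The component of an endomorphism at `v`. -/
def partV (ι : V →ₗ[K] Z) (p : Z →ₗ[K] W) : (sequenceRep ι p).endRing →+* Module.End K V :=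
  (sequenceRep ι p).proj Node.v

/-- The component of an endomorphism at `z`. -/
def partZ (ι : V →ₗ[K] Z) (p : Z →ₗ[K] W) : (sequenceRep ι p).endRing →+* Module.End K Z :=
  (sequenceRep ι p).proj Node.z

/-- The component of an endomorphism at `w`. -/
def partW (ι : V →ₗ[K] Z) (p : Z →ₗ[K] W) : (sequenceRep ι p).endRing →+* Module.End K W :=
  (sequenceRep ι p).proj Node.w

/-- The component of an automorphism at `w`. -/
def unitsW (ι : V →ₗ[K] Z) (p : Z →ₗ[K] W) :
    (sequenceRep ι p).aut →* LinearMap.GeneralLinearGroup K W :=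
  Units.map (partW ι p : (sequenceRep ι p).endRing →* Module.End K W)

theorem mem_liftGroup_iff (G : Subgroup (LinearMap.GeneralLinearGroup K W))
    (g : (sequenceRep ι p).aut) :
    g ∈ (sequenceRep ι p).liftGroup Node.w G ↔ unitsW ι p g ∈ G := Iff.rfl

theorem ι_comp_partV (X : (sequenceRep ι p).endRing) :
    ι ∘ₗ partV ι p X = partZ ι p X ∘ₗ ι := X.2 Arrow.vz

theorem p_comp_partZ (X : (sequenceRep ι p).endRing) :
    p ∘ₗ partZ ι p X = partW ι p X ∘ₗ p := X.2 Arrow.zw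

theorem endRing_ext (hι : Function.Injective ι) {X Y : (sequenceRep ι p).endRing}
    (hZ : partZ ι p X = partZ ι p Y) (hW : partW ι p X = partW ι p Y) : X = Y := by
  have hV : partV ι p X = partV ι p Y := by
    ext v
    refine hι ?_
    have h₁ := LinearMap.congr_fun (ι_comp_partV X) v
    have h₂ := LinearMap.congr_fun (ι_comp_partV Y) v
    rw [hZ] at h₁
    exact h₁.trans h₂.symm
  refine Subtype.ext (funext fun a => ?_)
  cases a
  exacts [hV, hZ, hW]

namespace Splitting

/-- The endomorphism of the sequence with given components at `z` and `w`. -/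
def mkEnd (σ : Splitting ι p) (X : Module.End K Z) (R : Module.End K W)
    (h : p ∘ₗ X = R ∘ₗ p) : (sequenceRep ι p).endRing :=
  ⟨fun a => match a with
    | .v => (σ.r ∘ₗ X ∘ₗ ι : Module.End K V)
    | .z => X
    | .w => R, by
    intro e
    cases e
    -- Since `X` covers `R`, it is block triangular and preserves the image of `ι`.
    · change ι ∘ₗ (σ.r ∘ₗ X ∘ₗ ι) = X ∘ₗ ι
      rw [σ.block_comp_ι (σ.r ∘ₗ X ∘ₗ ι) (σ.r ∘ₗ X ∘ₗ σ.s) R, σ.block_eq h]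
    · exact h⟩

/-- The automorphism of the sequence with given components at `z` and `w`. -/
def mkAut (σ : Splitting ι p) (hι : Function.Injective ι) (g : (Module.End K Z)ˣ)
    (h : LinearMap.GeneralLinearGroup K W)
    (hgh : p ∘ₗ (g : Module.End K Z) = (h : Module.End K W) ∘ₗ p) : (sequenceRep ι p).aut where
  val := σ.mkEnd g h hgh
  inv := σ.mkEnd (g⁻¹ : (Module.End K Z)ˣ) (h⁻¹ : LinearMap.GeneralLinearGroup K W) (by
    have h₁ : (g : Module.End K Z) ∘ₗ ((g⁻¹ : (Module.End K Z)ˣ) : Module.End K Z) =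
      LinearMap.id := g.mul_inv
    have h₂ : ((h⁻¹ : LinearMap.GeneralLinearGroup K W) : Module.End K W) ∘ₗ
      (h : Module.End K W) = LinearMap.id := h.inv_mul
    calc p ∘ₗ ((g⁻¹ : (Module.End K Z)ˣ) : Module.End K Z)
        = (((h⁻¹ : LinearMap.GeneralLinearGroup K W) : Module.End K W) ∘ₗ
          (h : Module.End K W)) ∘ₗ p ∘ₗ ((g⁻¹ : (Module.End K Z)ˣ) : Module.End K Z) := by
          rw [h₂, LinearMap.id_comp]
      _ = ((h⁻¹ : LinearMap.GeneralLinearGroup K W) : Module.End K W) ∘ₗ p ∘ₗ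
          (g : Module.End K Z) ∘ₗ ((g⁻¹ : (Module.End K Z)ˣ) : Module.End K Z) := by
          rw [LinearMap.comp_assoc, ← LinearMap.comp_assoc _ p (h : Module.End K W), ← hgh,
            LinearMap.comp_assoc]
      _ = _ := by rw [h₁, LinearMap.comp_id])
  val_inv := endRing_ext hι (by
    rw [map_mul, map_one]
    exact g.mul_inv) (by
    rw [map_mul, map_one]
    exact h.mul_inv)
  inv_val := endRing_ext hι (by
    rw [map_mul, map_one]
    exact g.inv_mul) (by
    rw [map_mul, map_one]
    exact h.inv_mul)

theorem mkAut_mem_liftGroup (σ : Splitting ι p) (hι : Function.Injective ι)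
    (g : (Module.End K Z)ˣ) {h : LinearMap.GeneralLinearGroup K W}
    (hgh : p ∘ₗ (g : Module.End K Z) = (h : Module.End K W) ∘ₗ p)
    {G : Subgroup (LinearMap.GeneralLinearGroup K W)} (hG : h ∈ G) :
    σ.mkAut hι g h hgh ∈ (sequenceRep ι p).liftGroup Node.w G := by
  have : unitsW ι p (σ.mkAut hι g h hgh) = h := Units.ext rfl
  rwa [mem_liftGroup_iff, this]

end Splitting

/-- The condition at `v` follows from that at `z`, as eigenvalues of a restriction are eigenvalues;
the condition at `w` is part of `A`. -/
theorem mem_liftSet_iff [FiniteDimensional K V] [FiniteDimensional K Z] [FiniteDimensional K W]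
    (hι : Function.Injective ι) {F : Set (AlgebraicClosure K)} {A : Set (Module.End K W)}
    (hAF : ∀ T ∈ A, InClass F T) (X : (sequenceRep ι p).endRing) :
    X ∈ (sequenceRep ι p).liftSet Node.w F A ↔ partW ι p X ∈ A ∧ InClass F (partZ ι p X) := by
  constructor
  · rintro ⟨h₁, h₂⟩
    exact ⟨h₁, h₂ Node.z⟩
  · rintro ⟨h₁, h₂⟩
    refine ⟨h₁, fun a => ?_⟩
    cases a
    exacts [InClass.of_injective hι (ι_comp_partV X) h₂, h₂, hAF _ h₁]

variable (G : Subgroup (LinearMap.GeneralLinearGroup K W))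

theorem card_liftGroup [Finite K] [FiniteDimensional K V] [FiniteDimensional K Z]
    [FiniteDimensional K W] (hι : Function.Injective ι) (hp : Function.Surjective p)
    (hex : Function.Exact ι p) :
    Nat.card ((sequenceRep ι p).liftGroup Node.w G) =
      Nat.card G * (Nat.card (Module.End K V)ˣ * Nat.card (W →ₗ[K] V)) := by
  obtain ⟨σ⟩ := Splitting.nonempty hι hp hex
  have := finite_end_units (K := K) (W := W)
  have := finite_hom (K := K) (V := Z) (W := Z)
  let _ := Fintype.ofFinite G
  let e : (Σ h : G, {g : Module.End K Z //
      IsUnit g ∧ p ∘ₗ g = (h.1 : Module.End K W) ∘ₗ p}) ≃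
      (sequenceRep ι p).liftGroup Node.w G :=
    { toFun := fun a => ⟨σ.mkAut hι a.2.2.1.unit a.1.1 a.2.2.2,
        σ.mkAut_mem_liftGroup hι _ _ a.1.2⟩
      invFun := fun g => ⟨⟨unitsW ι p g.1, (mem_liftGroup_iff G _).1 g.2⟩,
        ⟨partZ ι p g.1.1, g.1.isUnit.map (partZ ι p), p_comp_partZ _⟩⟩
      left_inv := fun a => rfl
      right_inv := fun g => Subtype.ext (Units.ext (endRing_ext hι rfl rfl)) }
  rw [← Nat.card_congr e, Nat.card_sigma,
    Finset.sum_congr rfl fun h _ => card_unit_lifts hι hp hex h.1.isUnit, Finset.sum_const,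
    Finset.card_univ, ← Nat.card_eq_fintype_card (α := G), smul_eq_mul]

theorem conjAction_smul_eq_iff {M : Type*} [Monoid M] (g : Mˣ) (x : M) :
    (conjAction M).smul g x = x ↔ (g : M) * x = x * g := by
  change (g : M) * x * ((g⁻¹ : Mˣ) : M) = x ↔ _
  rw [Units.mul_inv_eq_iff_eq_mul]

/-- Burnside upstairs. The components at `z` and `w` determine an endomorphism of the sequence, so
the commuting pairs above (h, R) are its commuting lifts along `p`. -/
theorem orbitCount_liftSet_mul_card [Finite K] [FiniteDimensional K V] [FiniteDimensional K Z]
    [FiniteDimensional K W] (hι : Function.Injective ι) (hp : Function.Surjective p)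
    (hex : Function.Exact ι p) {F : Set (AlgebraicClosure K)} {A : Set (Module.End K W)}
    (hAF : ∀ T ∈ A, InClass F T)
    (hGA : ∀ g ∈ G, ∀ T ∈ A, (g : Module.End K W) * T *
      ((g⁻¹ : LinearMap.GeneralLinearGroup K W) : Module.End K W) ∈ A)
    [Fintype (commutingPairs G A)] :
    orbitCount (conjAction (sequenceRep ι p).endRing) ((sequenceRep ι p).liftGroup Node.w G)
        ((sequenceRep ι p).liftSet Node.w F A) *
        Nat.card ((sequenceRep ι p).liftGroup Node.w G) =
      ∑ c : commutingPairs G A, Nat.card (commutingLifts F p (c.1.1 : Module.End K W) c.1.2) := by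
  obtain ⟨σ⟩ := Splitting.nonempty hι hp hex
  have := finite_hom (K := K) (V := Z) (W := Z)
  have hst : ∀ g ∈ (sequenceRep ι p).liftGroup Node.w G,
      ∀ X ∈ (sequenceRep ι p).liftSet Node.w F A,
      (conjAction (sequenceRep ι p).endRing).smul g X ∈ (sequenceRep ι p).liftSet Node.w F A := by
    intro g hg X hX
    rw [mem_liftSet_iff hι hAF] at hX ⊢
    change partW ι p ((g : (sequenceRep ι p).endRing) * X * (g⁻¹ : (sequenceRep ι p).aut)) ∈ A ∧
      InClass F (partZ ι p ((g : (sequenceRep ι p).endRing) * X * (g⁻¹ : (sequenceRep ι p).aut)))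
    refine ⟨?_, ?_⟩
    · rw [map_mul, map_mul]
      exact hGA (unitsW ι p g) ((mem_liftGroup_iff G g).1 hg) _ hX.1
    · have hu := (Module.End.isUnit_iff _).1 (g.isUnit.map (partZ ι p))
      refine InClass.of_surjective (p := partZ ι p g) hu.2 ?_ hX.2
      change partZ ι p g * partZ ι p X = partZ ι p _ * partZ ι p g
      rw [← map_mul, ← map_mul, Units.inv_mul_cancel_right]
  rw [orbitCount_mul_card _ _ _ hst, ← Nat.card_sigma]
  refine Nat.card_congr
    { toFun := fun q => ⟨⟨(unitsW ι p q.1.1, partW ι p q.1.2),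
        (mem_liftGroup_iff G _).1 q.2.1, q.2.2.1.1, ?_⟩, ⟨(partZ ι p q.1.1, partZ ι p q.1.2),
        ⟨q.1.1.isUnit.map (partZ ι p), ((mem_liftSet_iff hι hAF _).1 q.2.2.1).2, ?_⟩,
        p_comp_partZ _, p_comp_partZ _⟩⟩
      invFun := fun a => ⟨(σ.mkAut hι a.2.2.1.1.unit a.1.1.1 a.2.2.2.2,
        σ.mkEnd a.2.1.2 a.1.1.2 a.2.2.2.1), ?_, ?_, ?_⟩
      left_inv := fun q => Subtype.ext (Prod.ext (Units.ext (endRing_ext hι rfl rfl))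
        (endRing_ext hι rfl rfl))
      right_inv := fun a => rfl }
  · have := congrArg (partW ι p) ((conjAction_smul_eq_iff _ _).1 q.2.2.2)
    rwa [map_mul, map_mul] at this
  · have := congrArg (partZ ι p) ((conjAction_smul_eq_iff _ _).1 q.2.2.2)
    rwa [map_mul, map_mul] at this
  · exact σ.mkAut_mem_liftGroup hι _ _ a.1.2.1
  · exact (mem_liftSet_iff hι hAF _).2 ⟨a.1.2.2.1, a.2.2.1.2.1⟩
  · refine (conjAction_smul_eq_iff _ _).2 (endRing_ext hι ?_ ?_)
    · rw [map_mul, map_mul]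
      exact a.2.2.1.2.2
    · rw [map_mul, map_mul]
      exact a.1.2.2.2

end SequenceRep

end QuiverCount

/-! ### The orbit formula -/

open QuiverCount in
theorem mainTheorem2 {K : Type v} [Field K] [Finite K]
    {V Z W : Type u} [AddCommGroup V] [Module K V] [AddCommGroup Z] [Module K Z]
    [AddCommGroup W] [Module K W] [FiniteDimensional K V] [FiniteDimensional K W]
    (k m : ℕ) (hV : Module.finrank K V = k) (hW : Module.finrank K W = m)
    (ι : V →ₗ[K] Z) (p : Z →ₗ[K] W)
    (hι : Function.Injective ι) (hp : Function.Surjective p) (hex : Function.Exact ι p)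
    (F : Set (AlgebraicClosure K))
    (G : Subgroup (LinearMap.GeneralLinearGroup K W)) (A : Set (Module.End K W))
    (hAF : ∀ T ∈ A, QuiverCount.InClass F T)
    (hGA : ∀ g ∈ G, ∀ T ∈ A, (g : Module.End K W) * T *
      ((g⁻¹ : LinearMap.GeneralLinearGroup K W) : Module.End K W) ∈ A) :
    QuiverCount.orbitCount
        (QuiverCount.conjAction (QuiverCount.sequenceRep ι p).endRing)
        ((QuiverCount.sequenceRep ι p).liftGroup QuiverCount.Node.w G)
        ((QuiverCount.sequenceRep ι p).liftSet QuiverCount.Node.w F A) =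
      ∑ j ∈ Finset.range (k + 1), QuiverCount.classNumber F (k - j) *
        ∑ lam ∈ QuiverCount.boundedPartitions j m,
          QuiverCount.xi (QuiverCount.partsList lam) G A := by
  subst hW
  obtain ⟨σ⟩ := Splitting.nonempty hι hp hex
  have hZ : FiniteDimensional K Z :=
    Module.Finite.of_surjective (ι.coprod σ.s) fun z => ⟨(σ.r z, p z), σ.sum_eq z⟩
  have := finite_end_units (K := K) (W := W)
  have := finite_hom (K := K) (V := W) (W := W)
  have := finite_hom (K := K) (V := V) (W := V)
  have := finite_hom (K := K) (V := W) (W := V)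
  let _ := Fintype.ofFinite (commutingPairs G A)
  -- `V` is replaced by `K^k`, on which the recursion is stated.
  let e : (Fin k → K) ≃ₗ[K] V := LinearEquiv.ofFinrankEq _ _ (by rw [Module.finrank_fin_fun, hV])
  have hι' : Function.Injective (ι ∘ₗ (e : (Fin k → K) →ₗ[K] V)) := hι.comp e.injective
  have hex' : Function.Exact (ι ∘ₗ (e : (Fin k → K) →ₗ[K] V)) p := by
    rw [LinearMap.exact_iff, LinearMap.range_comp, LinearEquiv.range, Submodule.map_top]
    exact hex.linearMap_ker_eq
  set H := Nat.card (W →ₗ[K] (Fin k → K)) with hH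
  have hHV : Nat.card (W →ₗ[K] V) = H := (Nat.card_congr (e.congrRight).toEquiv).symm
  have hGL : Nat.card (Module.End K V)ˣ = cardGL K k :=
    (Nat.card_congr (Units.mapEquiv (e.conjRingEquiv : _ ≃* _)).toEquiv).symm
  have hHpos : (H : ℚ) ≠ 0 := by
    have := finite_hom (K := K) (V := W) (W := Fin k → K)
    exact Nat.cast_ne_zero.2 Nat.card_pos.ne'
  have hgpos : (cardGL K k : ℚ) ≠ 0 := Nat.cast_ne_zero.2 (cardGL_pos k).ne'
  have hGpos : (Nat.card G : ℚ) ≠ 0 := Nat.cast_ne_zero.2 Nat.card_pos.ne'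
  have hL := orbitCount_liftSet_mul_card G hι hp hex hAF hGA
  rw [card_liftGroup G hι hp hex, hHV, hGL] at hL
  have hD : ∀ c : commutingPairs G A,
      (Nat.card (commutingLifts F p (c.1.1 : Module.End K W) c.1.2) : ℚ) = H * cardGL K k *
        ∑ j ∈ Finset.range (k + 1), (classNumber F (k - j) : ℚ) *
          Nat.card (invariantFlags (c.1.1 : Module.End K W) c.1.2 j ⊤) := by
    intro c
    have hR := hAF _ c.2.2.1
    rw [card_commutingLifts hι' hp hex' c.1.1.isUnit c.2.2.2 hR,
      ← card_mapsInto_div_eq_sum c.1.1.isUnit c.2.2.2 hR, mul_assoc, mul_div_cancel₀ _ hgpos,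
      Nat.cast_mul]
    have htop : mapsInto F (c.1.1 : Module.End K W) c.1.2 k ⊤ =
        equivariantMaps F (Fin k → K) (c.1.1 : Module.End K W) c.1.2 := by
      ext x
      simp [mapsInto]
    rw [htop]
  have hX : ∀ j, (∑ lam ∈ boundedPartitions j (Module.finrank K W),
      (xi (partsList lam) G A : ℚ)) * Nat.card G = ∑ c : commutingPairs G A,
        (Nat.card (invariantFlags (c.1.1 : Module.End K W) c.1.2 j ⊤) : ℚ) := by
    intro j
    simp only [← sum_card_invariantFlagsOfType]
    rw [Finset.sum_mul]
    push_cast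
    rw [Finset.sum_comm]
    refine Finset.sum_congr rfl fun lam _ => ?_
    rw [← Nat.cast_mul, xi_mul_card hGA, Nat.cast_sum]
  have hL' := congrArg (Nat.cast : ℕ → ℚ) hL
  push_cast at hL'
  rw [Finset.sum_congr rfl fun c _ => hD c, ← Finset.mul_sum, Finset.sum_comm] at hL'
  rw [← Nat.cast_inj (R := ℚ)]
  push_cast
  -- The cancelled factor is the order of the lifted group, |G| · |GL_k| · |Hom(W, K^k)|.
  refine mul_right_cancel₀ (mul_ne_zero hGpos (mul_ne_zero hgpos hHpos)) (hL'.trans ?_)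
  have : ∀ j, ∑ c : commutingPairs G A, (classNumber F (k - j) : ℚ) *
      Nat.card (invariantFlags (c.1.1 : Module.End K W) c.1.2 j ⊤) = classNumber F (k - j) *
      (∑ lam ∈ boundedPartitions j (Module.finrank K W), (xi (partsList lam) G A : ℚ)) *
        Nat.card G := by
    intro j
    rw [← Finset.mul_sum, ← hX, mul_assoc]
  rw [Finset.sum_congr rfl fun j _ => this j, ← Finset.sum_mul]
  ring
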